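/- Theorem 2.6. Let $\mathbb F$ be $\mathbb R$, $\mathbb C$ or $\mathbb H$ (the real quaternions), let $F$ be a subfield of $\mathbb R$, and view $F\subseteq\mathbb R\subseteq\mathbb F$. Let $\mathcal S\subseteq M_n(\mathbb F)$ be a set of matrices closed under multiplication. View the members of $M_n(\mathbb F)$ as linear maps acting on the left of the right $\mathbb F$-vector space $\mathbb F^n$ of column vectors. Suppose that (a) $\mathcal S$ is irreducible: for every nonzero $x\in\mathbb F^n$, the orbit $\{Ax : A\in\mathcal S\}$ spans $\mathbb F^n$ as a right $\mathbb F$-vector space; (b) each individual $A\in\mathcal S$ is triangularizable: there are $A$-invariant subspaces $\{0\}=\mathcal V_0\subseteq\mathcal V_1\subseteq\cdots\subseteq\mathcal V_n=\mathbb F^n$ with $\dim\mathcal V_j=j$ for all $j$; (c) for each $A\in\mathcal S$ the spectrum of $A$, i.e. the set of its right eigenvalues $\{\lambda\in\mathbb F : Ax=x\lambda \text{ for some nonzero } x\in\mathbb F^n\}$, is contained in $F$. Let $\mathrm{Alg}_F(\mathcal S)$ be the $F$-algebra generated by $\mathcal S$, i.e. the smallest (not necessarily unital) subring of $M_n(\mathbb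 F)$ that contains $\mathcal S$ and is closed under multiplication by scalars from $F$; equivalently, the $F$-linear span of $\mathcal S$. Then $\mathrm{Alg}_F(\mathcal S)$ is similar to $M_n(F)$: there is an invertible matrix $P\in M_n(\mathbb F)$ such that $$\mathrm{Alg}_F(\mathcal S)=P^{-1}M_n(F)P=\{P^{-1}BP : B\in M_n(F)\}.$$ -/

import Mathlib

open scoped Matrix Quaternion

namespace MatrixSemigroup

variable {D : Type*} [DivisionRing D] {n : ℕ}

/-- A family `𝓕` of matrices in `M_n(D)` is irreducible if, for every nonzero column vector `x`, the
orbit of `x` under the multiplicative semigroup generated by `𝓕` spans the right vector space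
`D^n` (a right `D`-space is a module over `Dᵐᵒᵖ`). -/
def IsIrreducible (𝓕 : Set (Matrix (Fin n) (Fin n) D)) : Prop :=
  ∀ x : Fin n → D, x ≠ 0 →
    Submodule.span Dᵐᵒᵖ
      ((fun A : Matrix (Fin n) (Fin n) D => A *ᵥ x) ''
        (Subsemigroup.closure 𝓕 : Set (Matrix (Fin n) (Fin n) D))) = ⊤

/-- A family `𝓕` of matrices in `M_n(D)` is triangularizable if its members have a common chain
`{0} = V_0 ⊆ V_1 ⊆ ⋯ ⊆ V_n = D^n` of invariant subspaces with `dim V_j = j`. -/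
def IsTriangularizable (𝓕 : Set (Matrix (Fin n) (Fin n) D)) : Prop :=
  ∃ V : Fin (n + 1) → Submodule Dᵐᵒᵖ (Fin n → D),
    Monotone V ∧ V 0 = ⊥ ∧ V (Fin.last n) = ⊤ ∧
      (∀ j, Module.finrank Dᵐᵒᵖ (V j) = (j : ℕ)) ∧
      ∀ A ∈ 𝓕, ∀ j, ∀ v ∈ V j, A *ᵥ v ∈ V j

/-- The spectrum of a matrix: the set of its right eigenvalues, i.e. of all `l` in `D` with
`A x = x l` for some nonzero column vector `x`. -/
def rightSpectrum (A : Matrix (Fin n) (Fin n) D) : Set D :=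
  {l | ∃ x : Fin n → D, x ≠ 0 ∧ A *ᵥ x = fun i => x i * l}

/-- Similarity of subsets of `M_n(D)`: `𝓐 = P⁻¹ 𝓑 P` for an invertible matrix `P` in `M_n(D)`. -/
def IsSimilar (𝓐 𝓑 : Set (Matrix (Fin n) (Fin n) D)) : Prop :=
  ∃ P : (Matrix (Fin n) (Fin n) D)ˣ,
    𝓐 = (fun B : Matrix (Fin n) (Fin n) D => (↑P⁻¹ : Matrix (Fin n) (Fin n) D) * B *
      (↑P : Matrix (Fin n) (Fin n) D)) '' 𝓑

variable (D) [Algebra ℝ D]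

/-- A subfield `F` of `ℝ` viewed as a subset of the real algebra `D`. -/
def scalars (F : Subfield ℝ) : Set D :=
  algebraMap ℝ D '' (F : Set ℝ)

variable (n) in
/-- `M_n(F)` viewed as a subset of `M_n(D)`: the matrices all of whose entries lie in `F`. -/
def matricesOver (F : Subfield ℝ) : Set (Matrix (Fin n) (Fin n) D) :=
  {A | ∀ i j, A i j ∈ scalars D F}

variable {D}

/-- `Alg_F(𝓢)`: the `F`-algebra generated by `𝓢`, that is, the smallest (not necessarily unital)
subring of `M_n(D)` that contains `𝓢` and is closed under multiplication by scalars from `F`. -/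
noncomputable def algGen (F : Subfield ℝ) (𝓢 : Set (Matrix (Fin n) (Fin n) D)) :
    NonUnitalSubalgebra F (Matrix (Fin n) (Fin n) D) :=
  NonUnitalAlgebra.adjoin F 𝓢

/-- For a semigroup, the `F`-algebra that it generates is its `F`-linear span. -/
theorem algGen_eq_span (F : Subfield ℝ) (S : Subsemigroup (Matrix (Fin n) (Fin n) D)) :
    (algGen F (S : Set (Matrix (Fin n) (Fin n) D))).toSubmodule =
      Submodule.span F (S : Set (Matrix (Fin n) (Fin n) D)) := by
  rw [algGen, NonUnitalAlgebra.adjoin_eq_span, Subsemigroup.closure_eq]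

end MatrixSemigroup

/-! The aim is a rank-one matrix $yt$ in $\mathrm{Alg}_F(\mathcal S)$ with $tBy\in F$ for every $B$
in the algebra. Irreducibility then supplies a basis $x_i=A_iy$ and dual rows $tG_j$, and in these
coordinates the algebra is exactly $M_n(F)$ (`isSimilar_matricesOver_of_rank_one`).

Rank one is reached by analysis. Each $A\in\mathcal S$ is annihilated by a product of factors
$X-l_i$ with $l_i\in F$ eigenvalues of $A$. This passes to limits, so every member of the closed
cone over $\mathcal S$ has real eigenvectors in its nonzero invariant subspaces. Let $W$ be the
range of a nonzero member of minimal rank. A member $X$ mapping into $W$ is zero or bijective on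
$W$, and so are the limits of its normalized powers; hence no direction in $W$ grows faster than
another, and $X^2$ is a positive scalar on $W$ (`IsMinimalRange.exists_sq_eq_smul`). Positivity of
the scalars of $X^2$, $Y^2$ and $(XY)^2$ makes such maps commute, and irreducibility makes them real
scalars. So $W$ is a line, and the cone contains a rank-one idempotent $E$.

To return from the cone to the algebra, approximate $E$ by $r_kA_k$ and cut off the eigenvalues
tending to $0$ with a polynomial in $A_k$ over $F$ (`exists_vecMulVec_mem_algGen`). The corner is
real after rescaling, and the real trace places it in $F$. -/

namespace MatrixSemigroup

open scoped Matrix.Norms.Operator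
open Polynomial Filter Topology MulOpposite

/-! ### Linear algebra over a division ring; roots of a triangularizable matrix. -/

section Algebra

variable {D : Type*} [DivisionRing D] {n : ℕ}

/-- Left multiplication by a matrix as an endomorphism of the right vector space `D^n`. -/
abbrev mulVecOp (A : Matrix (Fin n) (Fin n) D) : (Fin n → D) →ₗ[Dᵐᵒᵖ] (Fin n → D) :=
  Matrix.mulVecBilin D Dᵐᵒᵖ A

instance finite_op : Module.Finite Dᵐᵒᵖ D :=
  ⟨⟨{1}, by
    rw [Finset.coe_singleton, Submodule.eq_top_iff']
    exact fun x => Submodule.mem_span_singleton.2 ⟨op x, by simp⟩⟩⟩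

theorem finrank_op : Module.finrank Dᵐᵒᵖ D = 1 :=
  finrank_eq_one (1 : D) one_ne_zero fun w => ⟨op w, by simp⟩

theorem finrank_op_pi : Module.finrank Dᵐᵒᵖ (Fin n → D) = n := by
  rw [Module.finrank_pi_fintype]
  simp [finrank_op]

theorem exists_ne_zero_map_eq_zero_of_finrank_lt {V : Type*} [AddCommGroup V] [Module Dᵐᵒᵖ V] [Module.Finite Dᵐᵒᵖ V]
    {f : V →ₗ[Dᵐᵒᵖ] V} {U W : Submodule Dᵐᵒᵖ V} (h : ∀ v ∈ U, f v ∈ W)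
    (hlt : Module.finrank Dᵐᵒᵖ W < Module.finrank Dᵐᵒᵖ U) : ∃ y ∈ U, y ≠ 0 ∧ f y = 0 := by
  by_contra! hc
  have hinj : Function.Injective (f.restrict h) := by
    rw [← LinearMap.ker_eq_bot, LinearMap.ker_eq_bot']
    rintro ⟨y, hy⟩ h0
    by_contra hne
    refine hc y hy (fun h1 => hne (Subtype.ext h1)) ?_
    simpa using congrArg Subtype.val h0
  exact absurd (LinearMap.finrank_le_finrank_of_injective hinj) (not_le.2 hlt)

theorem exists_mulVec_ne_zero_of_span_eq_top {𝓒 : Set (Matrix (Fin n) (Fin n) D)}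
    {x : Fin n → D}
    (h : Submodule.span Dᵐᵒᵖ ((fun A : Matrix (Fin n) (Fin n) D => A *ᵥ x) '' 𝓒) = ⊤)
    {T : Matrix (Fin n) (Fin n) D} (hT : T ≠ 0) : ∃ A ∈ 𝓒, T *ᵥ (A *ᵥ x) ≠ 0 := by
  by_contra! h0
  apply hT
  have hle : (⊤ : Submodule Dᵐᵒᵖ (Fin n → D)) ≤ (mulVecOp T).ker := by
    rw [← h, Submodule.span_le]
    rintro _ ⟨A, hA, rfl⟩
    exact h0 A hA
  exact Matrix.ext_of_mulVec_single fun i => by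
    rw [Matrix.zero_mulVec]; exact hle (Submodule.mem_top (x := Pi.single i 1))

theorem IsIrreducible.exists_mulVec_ne_zero {S : Subsemigroup (Matrix (Fin n) (Fin n) D)}
    (hirr : IsIrreducible (S : Set (Matrix (Fin n) (Fin n) D))) {T : Matrix (Fin n) (Fin n) D}
    (hT : T ≠ 0) {x : Fin n → D} (hx : x ≠ 0) : ∃ A ∈ S, T *ᵥ (A *ᵥ x) ≠ 0 := by
  have h := hirr x hx
  rw [Subsemigroup.closure_eq] at h
  exact exists_mulVec_ne_zero_of_span_eq_top h hT

variable [Algebra ℝ D]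

/-- Irreducible real polynomials have degree at most two, in particular the minimal polynomial of
$m$. -/
theorem exists_quadratic [FiniteDimensional ℝ D] (m : D) :
    ∃ t s : ℝ, m * m = t • m - s • (1 : D) := by
  have hint : IsIntegral ℝ m := Algebra.IsIntegral.isIntegral m
  have hdeg := (minpoly.irreducible hint).natDegree_le_two
  have hmon := minpoly.monic hint
  have h0 := minpoly.aeval ℝ m
  have hcases : (minpoly ℝ m).natDegree = 1 ∨ (minpoly ℝ m).natDegree = 2 := by
    have := minpoly.natDegree_pos hint
    omega
  rw [aeval_eq_sum_range] at h0
  have hlead : (minpoly ℝ m).coeff (minpoly ℝ m).natDegree = 1 := hmon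
  rcases hcases with h | h <;> rw [h] at h0 hlead <;>
    simp only [Finset.sum_range_succ, Finset.range_zero, Finset.sum_empty, hlead] at h0 <;>
    simp only [pow_zero, pow_one, one_smul, zero_add] at h0
  · refine ⟨-(minpoly ℝ m).coeff 0, 0, ?_⟩
    have hm : m = (-(minpoly ℝ m).coeff 0) • (1 : D) := by
      rw [neg_smul]; exact eq_neg_of_add_eq_zero_right h0
    rw [zero_smul, sub_zero]
    nth_rw 1 [hm]
    simp
  · refine ⟨-(minpoly ℝ m).coeff 1, (minpoly ℝ m).coeff 0, ?_⟩
    rw [neg_smul, ← sq]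
    rw [add_comm] at h0
    rw [eq_neg_of_add_eq_zero_left h0]
    abel

theorem algebraMap_mulVec (c : ℝ) (v : Fin n → D) :
    (algebraMap ℝ (Matrix (Fin n) (Fin n) D) c) *ᵥ v = c • v := by
  rw [Algebra.algebraMap_eq_smul_one, Matrix.smul_mulVec, Matrix.one_mulVec]

theorem aeval_mul_X_sub_C_mulVec (A : Matrix (Fin n) (Fin n) D) (p : ℝ[X]) (c : ℝ)
    (v : Fin n → D) :
    aeval A (p * (X - C c)) *ᵥ v = aeval A p *ᵥ (A *ᵥ v - c • v) := by
  simp only [map_mul, map_sub, aeval_X, aeval_C]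
  rw [← Matrix.mulVec_mulVec, Matrix.sub_mulVec, algebraMap_mulVec]

theorem op_smul_algebraMap (c : ℝ) (v : Fin n → D) : op (algebraMap ℝ D c) • v = c • v := by
  ext i; simp [Algebra.smul_def, Algebra.commutes]

theorem real_smul_mem (W : Submodule Dᵐᵒᵖ (Fin n → D)) (c : ℝ) {v : Fin n → D} (hv : v ∈ W) :
    c • v ∈ W := by
  rw [← op_smul_algebraMap]; exact W.smul_mem _ hv

/-- If `A` leaves the consecutive members `U ⊆ W` of a chain invariant, then it acts on `W / U` as
an element of its spectrum, provided that the spectrum is contained in a subfield of `ℝ`. -/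
theorem exists_eigenvalue_on_quotient [FiniteDimensional ℝ D] {F : Subfield ℝ}
    {A : Matrix (Fin n) (Fin n) D} (hA : rightSpectrum A ⊆ scalars D F)
    {U W : Submodule Dᵐᵒᵖ (Fin n → D)} (hUW : U ≤ W)
    (hrank : Module.finrank Dᵐᵒᵖ W = Module.finrank Dᵐᵒᵖ U + 1)
    (hU : ∀ v ∈ U, A *ᵥ v ∈ U) (hW : ∀ v ∈ W, A *ᵥ v ∈ W) :
    ∃ l ∈ F, (∃ y, y ≠ 0 ∧ A *ᵥ y = l • y) ∧ ∀ v ∈ W, A *ᵥ v - l • v ∈ U := by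
  have hlt : Module.finrank Dᵐᵒᵖ U < Module.finrank Dᵐᵒᵖ W := by omega
  obtain ⟨v, hvW, hvU⟩ : ∃ v ∈ W, v ∉ U := by
    by_contra! h
    exact absurd (Submodule.finrank_mono (R := Dᵐᵒᵖ) (s := W) (t := U) h) (not_le.2 hlt)
  have hspan : ∀ u ∈ W, ∃ (d : D), u - op d • v ∈ U := by
    have hle : U ⊔ Submodule.span Dᵐᵒᵖ {v} ≤ W :=
      sup_le hUW ((Submodule.span_singleton_le_iff_mem _ _).2 hvW)
    have hlt' : U < U ⊔ Submodule.span Dᵐᵒᵖ {v} :=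
      lt_of_le_of_ne le_sup_left fun h => hvU <| by
        rw [h]; exact Submodule.mem_sup_right (Submodule.mem_span_singleton_self v)
    have h2 := Submodule.finrank_lt_finrank_of_lt hlt'
    have heq := Submodule.eq_of_le_of_finrank_le hle (by omega)
    intro u hu
    rw [← heq, Submodule.mem_sup] at hu
    obtain ⟨y, hy, z, hz, rfl⟩ := hu
    obtain ⟨c, rfl⟩ := Submodule.mem_span_singleton.1 hz
    exact ⟨unop c, by simpa using hy⟩
  obtain ⟨m, hm⟩ := hspan _ (hW v hvW)
  have hfin : ∀ f : (Fin n → D) →ₗ[Dᵐᵒᵖ] (Fin n → D), (∀ u ∈ U, f u ∈ U) → f v ∈ U →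
      ∀ u ∈ W, f u ∈ U := by
    intro f hf hv u hu
    obtain ⟨d, hd⟩ := hspan u hu
    have : f u = f (u - op d • v) + op d • f v := by simp
    rw [this]
    exact U.add_mem (hf _ hd) (U.smul_mem _ hv)
  -- $A$ acts on the line $W/U$ through $m$, and $q$ is a real quadratic vanishing at $m$. So $q(A)$
  -- maps $W$ into the smaller $U$ and kills some $y\ne0$. Since $(t-m)m=s$, the vector $Ay-y(t-m)$
  -- is either zero, and $t-m$ is an eigenvalue, or an eigenvector for $m$. Either way $m$ is real.
  have hreal : ∃ l : ℝ, m = algebraMap ℝ D l := by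
    obtain ⟨t, s, hts⟩ := exists_quadratic m
    let q : Matrix (Fin n) (Fin n) D := A * A - t • A + s • (1 : Matrix (Fin n) (Fin n) D)
    have hq : ∀ u, mulVecOp q u = A *ᵥ (A *ᵥ u) - t • (A *ᵥ u) + s • u := by
      intro u
      simp only [q, Matrix.mulVecBilin_apply, Matrix.add_mulVec, Matrix.sub_mulVec,
        Matrix.smul_mulVec, Matrix.mulVec_mulVec, Matrix.one_mulVec]
    have hqU : ∀ u ∈ W, mulVecOp q u ∈ U := by
      refine hfin _ ?_ ?_
      · intro u hu
        rw [hq]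
        exact U.add_mem (U.sub_mem (hU _ (hU _ hu)) (real_smul_mem _ _ (hU _ hu)))
          (real_smul_mem _ _ hu)
      · obtain ⟨w, hw⟩ : ∃ w, w = A *ᵥ v - op m • v := ⟨_, rfl⟩
        rw [← hw] at hm
        have hAv : A *ᵥ v = w + op m • v := by rw [hw]; abel
        have : mulVecOp q v = A *ᵥ w + op m • w - t • w := by
          rw [hq, hAv, Matrix.mulVec_add, Matrix.mulVec_smul, hAv]
          have : op m • op m • v = t • op m • v - s • v := by
            rw [smul_smul, ← op_mul, hts]
            ext i
            simp [mul_sub]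
          rw [smul_add, this, smul_add]
          abel
        rw [this]
        exact U.sub_mem (U.add_mem (hU _ hm) (U.smul_mem _ hm)) (real_smul_mem _ _ hm)
    obtain ⟨y, -, hy0, hy⟩ := exists_ne_zero_map_eq_zero_of_finrank_lt hqU hlt
    rw [hq] at hy
    have hAAy : A *ᵥ (A *ᵥ y) = t • (A *ᵥ y) - s • y := by
      rw [eq_sub_iff_add_eq, ← sub_eq_zero, ← hy]; abel
    have hcomm' : (algebraMap ℝ D t - m) * m = algebraMap ℝ D s := by
      rw [sub_mul, hts, ← Algebra.smul_def, sub_sub_cancel, Algebra.algebraMap_eq_smul_one]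
    by_cases hx : A *ᵥ y - op (algebraMap ℝ D t - m) • y = 0
    · have : algebraMap ℝ D t - m ∈ rightSpectrum A := by
        refine ⟨y, hy0, ?_⟩
        rw [sub_eq_zero.1 hx]; rfl
      obtain ⟨l, -, hl⟩ := hA this
      exact ⟨t - l, by rw [map_sub, hl]; abel⟩
    · have : m ∈ rightSpectrum A := by
        refine ⟨_, hx, ?_⟩
        change _ = op m • (A *ᵥ y - op (algebraMap ℝ D t - m) • y)
        rw [Matrix.mulVec_sub, Matrix.mulVec_smul, hAAy, smul_sub, smul_smul, ← op_mul, hcomm']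
        rw [op_smul_algebraMap, op_sub, sub_smul, op_smul_algebraMap]
        abel
      obtain ⟨l, -, hl⟩ := hA this
      exact ⟨l, hl.symm⟩
  obtain ⟨l, rfl⟩ := hreal
  rw [op_smul_algebraMap] at hm
  have hsub : ∀ u, mulVecOp (A - l • (1 : Matrix (Fin n) (Fin n) D)) u = A *ᵥ u - l • u := by
    intro u; simp only [Matrix.mulVecBilin_apply, Matrix.sub_mulVec, Matrix.smul_mulVec,
      Matrix.one_mulVec]
  have hmap := hfin (mulVecOp (A - l • (1 : Matrix (Fin n) (Fin n) D)))
    (fun u hu => by rw [hsub]; exact U.sub_mem (hU _ hu) (real_smul_mem _ _ hu))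
    (by rw [hsub]; exact hm)
  obtain ⟨y, -, hy0, hy⟩ := exists_ne_zero_map_eq_zero_of_finrank_lt hmap hlt
  rw [hsub, sub_eq_zero] at hy
  refine ⟨l, ?_, ⟨y, hy0, hy⟩, fun u hu => by rw [← hsub]; exact hmap u hu⟩
  have : algebraMap ℝ D l ∈ rightSpectrum A :=
    ⟨y, hy0, by rw [hy, ← op_smul_algebraMap]; rfl⟩
  obtain ⟨l', hl', heq⟩ := hA this
  rwa [← (algebraMap ℝ D).injective heq]

/-- The factor for the $i$-th quotient of the chain pushes $V_{i+1}$ into $V_i$, so the product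
kills everything. The eigenvectors are recorded because they bound the roots by the norm of $A$. -/
theorem exists_annihilating_roots [FiniteDimensional ℝ D] {F : Subfield ℝ}
    {A : Matrix (Fin n) (Fin n) D} (hT : IsTriangularizable {A})
    (hA : rightSpectrum A ⊆ scalars D F) :
    ∃ l : Fin n → ℝ, (∀ i, l i ∈ F) ∧ (∀ i, ∃ y, y ≠ 0 ∧ A *ᵥ y = l i • y) ∧
      aeval A (∏ i, (X - C (l i))) = 0 := by
  obtain ⟨V, hmono, hV0, hVn, hrank, hinv⟩ := hT
  have key : ∀ i : Fin n, ∃ l ∈ F, (∃ y, y ≠ 0 ∧ A *ᵥ y = l • y) ∧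
      ∀ v ∈ V i.succ, A *ᵥ v - l • v ∈ V i.castSucc := fun i =>
    exists_eigenvalue_on_quotient hA (hmono (Fin.castSucc_le_succ i))
      (by simp [hrank]) (hinv A rfl _) (hinv A rfl _)
  choose l hlF hly hlV using key
  refine ⟨l, hlF, hly, ?_⟩
  have hprod : ∀ k : Fin (n + 1), ∀ v ∈ V k,
      aeval A (∏ i : Fin n with i.castSucc < k, (X - C (l i))) *ᵥ v = 0 := by
    intro k
    induction k using Fin.induction with
    | zero => intro v hv; rw [hV0, Submodule.mem_bot] at hv; simp [hv]
    | succ k ih =>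
      intro v hv
      have : (Finset.univ.filter fun i : Fin n => i.castSucc < k.succ)
          = insert k (Finset.univ.filter fun i : Fin n => i.castSucc < k.castSucc) := by
        ext i
        simp only [Finset.mem_filter_univ, Finset.mem_insert, Fin.lt_def, Fin.ext_iff,
          Fin.val_castSucc, Fin.val_succ]
        omega
      rw [this, Finset.prod_insert (by simp), mul_comm, aeval_mul_X_sub_C_mulVec]
      exact ih _ (hlV k v hv)
  have hall : ∀ v, aeval A (∏ i : Fin n, (X - C (l i))) *ᵥ v = 0 := by
    intro v
    have := hprod (Fin.last n) v (by rw [hVn]; trivial)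
    simpa [Fin.castSucc_lt_last] using this
  exact Matrix.ext_of_mulVec_single fun i => by rw [hall, Matrix.zero_mulVec]

end Algebra

/-! ### The closed real cone over the semigroup. -/

section Analysis

theorem tendsto_aeval_prod {R : Type*} [NormedRing R] [NormedAlgebra ℝ R] {ι κ : Type*}
    {f : Filter κ} {B : κ → R} {b : R} {l : κ → ι → ℝ} {a : ι → ℝ} (hB : Tendsto B f (𝓝 b))
    (hl : ∀ i, Tendsto (fun k => l k i) f (𝓝 (a i))) (J : Finset ι) :
    Tendsto (fun k => aeval (B k) (∏ i ∈ J, (X - C (l k i)))) f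
      (𝓝 (aeval b (∏ i ∈ J, (X - C (a i))))) := by
  classical
  induction J using Finset.induction_on with
  | empty => simpa using tendsto_const_nhds
  | insert i J hi ih =>
    simp only [Finset.prod_insert hi, map_mul, map_sub, aeval_X, aeval_C]
    exact (hB.sub (((continuous_algebraMap ℝ R).tendsto _).comp (hl i))).mul ih

theorem aeval_smul_prod {R : Type*} [Ring R] [Algebra ℝ R] {ι : Type*} (A : R) (r : ℝ)
    (l : ι → ℝ) (J : Finset ι) :
    aeval (r • A) (∏ i ∈ J, (X - C (r * l i))) =
      r ^ J.card • aeval A (∏ i ∈ J, (X - C (l i))) := by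
  classical
  induction J using Finset.induction_on with
  | empty => simp
  | insert i J hi ih =>
    simp only [Finset.prod_insert hi, map_mul, map_sub, aeval_X, aeval_C,
      Finset.card_insert_of_notMem hi]
    have : r • A - algebraMap ℝ R r * algebraMap ℝ R (l i) = r • (A - algebraMap ℝ R (l i)) := by
      rw [smul_sub, ← Algebra.smul_def]
    simp only [map_mul] at ih
    rw [this, ih, smul_mul_smul_comm, pow_succ']

theorem le_of_frequently_mul_pow_le {a b c : ℝ} (hc : 0 < c) (ha : 0 < a)
    (h : ∃ᶠ m : ℕ in atTop, c * b ^ m ≤ a ^ m) : b ≤ a := by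
  by_contra! hab
  have hb : 0 < b := ha.trans hab
  have ht := tendsto_pow_atTop_nhds_zero_of_lt_one (div_nonneg ha.le hb.le)
    ((div_lt_one hb).2 hab)
  refine h ((ht.eventually_lt_const hc).mono fun m hm => ?_)
  rw [div_pow, div_lt_iff₀ (by positivity)] at hm
  exact not_le.2 hm

variable {D : Type*} [NormedDivisionRing D] [NormedAlgebra ℝ D] {n : ℕ}

theorem exists_eigenvector_of_aeval_prod {ι : Type*} {A : Matrix (Fin n) (Fin n) D} {l : ι → ℝ}
    {U : Submodule ℝ (Fin n → D)} (hU : ∀ u ∈ U, A *ᵥ u ∈ U) (J : Finset ι) {u : Fin n → D}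
    (hu : u ∈ U) (hu0 : u ≠ 0) (h : aeval A (∏ i ∈ J, (X - C (l i))) *ᵥ u = 0) :
    ∃ i ∈ J, ∃ y ∈ U, y ≠ 0 ∧ A *ᵥ y = l i • y := by
  classical
  induction J using Finset.induction_on generalizing u with
  | empty => simp [hu0] at h
  | insert i J hi ih =>
    rw [Finset.prod_insert hi, mul_comm, aeval_mul_X_sub_C_mulVec] at h
    by_cases h0 : A *ᵥ u - l i • u = 0
    · exact ⟨i, Finset.mem_insert_self _ _, u, hu, hu0, sub_eq_zero.1 h0⟩
    · obtain ⟨j, hj, hy⟩ := ih (U.sub_mem (hU u hu) (U.smul_mem _ hu)) h0 h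
      exact ⟨j, Finset.mem_insert_of_mem hj, hy⟩

/-- The closure of the set of real multiples of the members of `𝓢`. -/
def realCone (𝓢 : Set (Matrix (Fin n) (Fin n) D)) : Set (Matrix (Fin n) (Fin n) D) :=
  closure {B | ∃ r : ℝ, ∃ A ∈ 𝓢, B = r • A}

/-- Members of the closed cone are limits of multiples of members of `𝓢` whose roots converge. -/
theorem exists_seq_of_mem_realCone {F : Subfield ℝ} {𝓢 : Set (Matrix (Fin n) (Fin n) D)}
    (h𝓢 : ∀ A ∈ 𝓢, ∃ l : Fin n → ℝ, (∀ i, l i ∈ F) ∧ (∀ i, ∃ y, y ≠ 0 ∧ A *ᵥ y = l i • y) ∧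
      aeval A (∏ i, (X - C (l i))) = 0)
    {B : Matrix (Fin n) (Fin n) D} (hB : B ∈ realCone 𝓢) :
    ∃ (r : ℕ → ℝ) (A : ℕ → Matrix (Fin n) (Fin n) D) (l : ℕ → Fin n → ℝ) (a : Fin n → ℝ),
      (∀ k, A k ∈ 𝓢) ∧ (∀ k i, l k i ∈ F) ∧ (∀ k, aeval (A k) (∏ i, (X - C (l k i))) = 0) ∧
      Tendsto (fun k => r k • A k) atTop (𝓝 B) ∧
      ∀ i, Tendsto (fun k => r k * l k i) atTop (𝓝 (a i)) := by
  have : FirstCountableTopology (Matrix (Fin n) (Fin n) D) :=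
    inferInstanceAs (FirstCountableTopology (Fin n → Fin n → D))
  obtain ⟨b, hb, hlim⟩ := mem_closure_iff_seq_limit.1 hB
  choose r A hA hbA using hb
  choose l hlF hly hl0 using fun k => h𝓢 (A k) (hA k)
  obtain ⟨K, hK⟩ := (Metric.isBounded_range_of_tendsto b hlim).exists_norm_le
  have hbound : ∀ k, (fun i => r k * l k i) ∈ Metric.closedBall (0 : Fin n → ℝ) (max K 0) := by
    intro k
    rw [mem_closedBall_zero_iff, pi_norm_le_iff_of_nonneg (le_max_right _ _)]
    intro i
    refine le_trans ?_ (le_max_left _ _)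
    -- The scaled root is an eigenvalue of $b_k$, hence at most $\|b_k\|$ in absolute value.
    obtain ⟨y, hy0, hy⟩ := hly k i
    have h1 := Matrix.linfty_opNorm_mulVec (b k) y
    have h2 : b k *ᵥ y = (r k * l k i) • y := by
      rw [hbA, Matrix.smul_mulVec, hy, smul_smul]
    rw [h2, norm_smul] at h1
    exact (le_of_mul_le_mul_right h1 (norm_pos_iff.2 hy0)).trans (hK _ ⟨k, rfl⟩)
  obtain ⟨a, -, φ, hφ, ha⟩ := (isCompact_closedBall _ _).tendsto_subseq hbound
  refine ⟨r ∘ φ, A ∘ φ, l ∘ φ, a, fun k => hA _, fun k => hlF _, fun k => hl0 _, ?_, ?_⟩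
  · have := hlim.comp hφ.tendsto_atTop
    refine this.congr fun k => ?_
    simp [hbA]
  · exact tendsto_pi_nhds.1 ha

/-- A closed real cone of matrices that is closed under multiplication, irreducible, and all of
whose members have a real eigenvector in each of their nonzero invariant real subspaces. -/
structure IsSplitCone (𝓒 : Set (Matrix (Fin n) (Fin n) D)) : Prop where
  isClosed : IsClosed 𝓒
  mul_mem : ∀ A ∈ 𝓒, ∀ B ∈ 𝓒, A * B ∈ 𝓒
  smul_mem : ∀ (r : ℝ), ∀ A ∈ 𝓒, r • A ∈ 𝓒
  span_eq_top : ∀ x : Fin n → D, x ≠ 0 →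
    Submodule.span Dᵐᵒᵖ ((fun A : Matrix (Fin n) (Fin n) D => A *ᵥ x) '' 𝓒) = ⊤
  exists_eigenvector : ∀ A ∈ 𝓒, ∀ U : Submodule ℝ (Fin n → D), (∀ u ∈ U, A *ᵥ u ∈ U) →
    ∀ u ∈ U, u ≠ 0 → ∃ l : ℝ, ∃ y ∈ U, y ≠ 0 ∧ A *ᵥ y = l • y

theorem subset_realCone (𝓢 : Set (Matrix (Fin n) (Fin n) D)) : 𝓢 ⊆ realCone 𝓢 :=
  fun A hA => subset_closure ⟨1, A, hA, (one_smul _ _).symm⟩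

/-- Only the eigenvectors need an argument: along a sequence with convergent scaled roots, the
annihilating products converge to a real split polynomial annihilating the limit. -/
theorem isSplitCone_realCone [FiniteDimensional ℝ D] {F : Subfield ℝ}
    {S : Subsemigroup (Matrix (Fin n) (Fin n) D)}
    (hirr : IsIrreducible (S : Set (Matrix (Fin n) (Fin n) D)))
    (hS : ∀ A ∈ S, ∃ l : Fin n → ℝ, (∀ i, l i ∈ F) ∧ (∀ i, ∃ y, y ≠ 0 ∧ A *ᵥ y = l i • y) ∧
      aeval A (∏ i, (X - C (l i))) = 0) :
    IsSplitCone (realCone (S : Set (Matrix (Fin n) (Fin n) D))) where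
  isClosed := isClosed_closure
  mul_mem A hA B hB := by
    refine map_mem_closure₂ continuous_mul hA hB ?_
    rintro _ ⟨r, A, hA, rfl⟩ _ ⟨s, B, hB, rfl⟩
    exact ⟨r * s, A * B, S.mul_mem hA hB, smul_mul_smul_comm _ _ _ _⟩
  smul_mem r A hA := by
    refine map_mem_closure (continuous_const_smul r) hA ?_
    rintro _ ⟨s, A, hA, rfl⟩
    exact ⟨r * s, A, hA, smul_smul _ _ _⟩
  span_eq_top x hx := by
    have := hirr x hx
    rw [Subsemigroup.closure_eq] at this
    exact top_unique (this ▸ Submodule.span_mono (Set.image_mono (subset_realCone _)))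
  exists_eigenvector A hA U hU u hu hu0 := by
    obtain ⟨r, B, l, a, hB, -, h0, hlim, ha⟩ := exists_seq_of_mem_realCone hS hA
    have h1 := tendsto_aeval_prod hlim ha Finset.univ
    simp only [aeval_smul_prod, h0, smul_zero] at h1
    have h2 := tendsto_nhds_unique h1 tendsto_const_nhds
    obtain ⟨i, -, y, hy⟩ := exists_eigenvector_of_aeval_prod hU Finset.univ hu hu0
      (l := a) (by rw [h2, Matrix.zero_mulVec])
    exact ⟨a i, y, hy⟩

/-- `W` is the range of a nonzero member of `𝓒` of minimal rank. -/
structure IsMinimalRange (𝓒 : Set (Matrix (Fin n) (Fin n) D))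
    (W : Submodule Dᵐᵒᵖ (Fin n → D)) : Prop where
  exists_range_eq : ∃ T ∈ 𝓒, (mulVecOp T).range = W
  ne_bot : W ≠ ⊥
  le_finrank : ∀ Y ∈ 𝓒, Y ≠ 0 →
    Module.finrank Dᵐᵒᵖ W ≤ Module.finrank Dᵐᵒᵖ (mulVecOp Y).range

/-! ### Members of minimal rank. -/

variable {𝓒 : Set (Matrix (Fin n) (Fin n) D)} {W : Submodule Dᵐᵒᵖ (Fin n → D)}

theorem IsSplitCone.exists_mulVec_ne_zero (h𝓒 : IsSplitCone 𝓒) {T : Matrix (Fin n) (Fin n) D}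
    (hT : T ≠ 0) {x : Fin n → D} (hx : x ≠ 0) : ∃ A ∈ 𝓒, T *ᵥ (A *ᵥ x) ≠ 0 :=
  exists_mulVec_ne_zero_of_span_eq_top (h𝓒.span_eq_top x hx) hT

theorem IsSplitCone.exists_isMinimalRange (h𝓒 : IsSplitCone 𝓒) (hn : 0 < n) :
    ∃ W, IsMinimalRange 𝓒 W := by
  classical
  have hne : ∃ A ∈ 𝓒, A ≠ 0 := by
    obtain ⟨A, hA, h⟩ := h𝓒.exists_mulVec_ne_zero (T := 1) (x := Pi.single ⟨0, hn⟩ (1 : D))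
      (fun h => by simpa using congrFun (congrFun h ⟨0, hn⟩) ⟨0, hn⟩) (by simp)
    exact ⟨A, hA, by rintro rfl; exact h (by rw [Matrix.zero_mulVec, Matrix.mulVec_zero])⟩
  have hex : ∃ r, ∃ A ∈ 𝓒, A ≠ 0 ∧ Module.finrank Dᵐᵒᵖ (mulVecOp A).range = r :=
    let ⟨A, hA, h0⟩ := hne
    ⟨_, A, hA, h0, rfl⟩
  obtain ⟨T, hT, hT0, hr⟩ := Nat.find_spec hex
  refine ⟨_, ⟨T, hT, rfl⟩, fun h => hT0 ?_, fun Y hY hY0 => ?_⟩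
  · rw [LinearMap.range_eq_bot] at h
    exact Matrix.ext_of_mulVec_single fun i => by
      rw [Matrix.zero_mulVec]; exact LinearMap.congr_fun h _
  · rw [hr]; exact Nat.find_min' hex ⟨Y, hY, hY0, rfl⟩

/-- If $W=\operatorname{ran}T$, then $XT$ is a nonzero member of the cone with range inside $W$;
minimality forces equality, so $X$ is onto $W$, and by dimension injective there. -/
theorem IsMinimalRange.bijOn (hW : IsMinimalRange 𝓒 W) (h𝓒 : IsSplitCone 𝓒)
    {X : Matrix (Fin n) (Fin n) D} (hX : X ∈ 𝓒) (hXW : ∀ v, X *ᵥ v ∈ W)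
    (h : ∃ w ∈ W, X *ᵥ w ≠ 0) :
    (∀ w ∈ W, X *ᵥ w = 0 → w = 0) ∧ ∀ w ∈ W, ∃ w' ∈ W, X *ᵥ w' = w := by
  obtain ⟨T, hT, rfl⟩ := hW.exists_range_eq
  obtain ⟨_, ⟨v, rfl⟩, hv⟩ := h
  have hne : X * T ≠ 0 := by
    intro h0
    apply hv
    rw [Matrix.mulVecBilin_apply, Matrix.mulVec_mulVec, h0, Matrix.zero_mulVec]
  have hle : (mulVecOp (X * T)).range ≤ (mulVecOp T).range := by
    rintro _ ⟨u, rfl⟩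
    rw [Matrix.mulVecBilin_apply, ← Matrix.mulVec_mulVec]
    exact hXW _
  have heq := Submodule.eq_of_le_of_finrank_le hle (hW.le_finrank _ (h𝓒.mul_mem _ hX _ hT) hne)
  have hsurj : ∀ w ∈ (mulVecOp T).range, ∃ w' ∈ (mulVecOp T).range, X *ᵥ w' = w := by
    intro w hw
    rw [← heq] at hw
    obtain ⟨u, rfl⟩ := hw
    exact ⟨T *ᵥ u, ⟨u, rfl⟩, by simp [Matrix.mulVec_mulVec]⟩
  refine ⟨fun w hw h0 => ?_, hsurj⟩
  have hs : Function.Surjective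
      ((mulVecOp X).restrict fun w (_ : w ∈ (mulVecOp T).range) => hXW w) := by
    rintro ⟨w, hw⟩
    obtain ⟨w', hw', rfl⟩ := hsurj w hw
    exact ⟨⟨w', hw'⟩, rfl⟩
  have hi := LinearMap.injective_iff_surjective.2 hs
  have := @hi ⟨w, hw⟩ 0 (Subtype.ext (by rw [map_zero]; exact h0))
  exact congrArg Subtype.val this

theorem IsSplitCone.pow_succ_mem (h𝓒 : IsSplitCone 𝓒) {X : Matrix (Fin n) (Fin n) D}
    (hX : X ∈ 𝓒) (m : ℕ) : X ^ (m + 1) ∈ 𝓒 := by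
  induction m with
  | zero => simpa using hX
  | succ m ih => rw [pow_succ]; exact h𝓒.mul_mem _ ih _ hX

/-- By compactness and minimality of rank, infinitely many powers of `X` are uniformly bounded
below on `W` relative to their norms. -/
theorem IsMinimalRange.frequently_le_norm_pow [FiniteDimensional ℝ D]
    (hW : IsMinimalRange 𝓒 W) (h𝓒 : IsSplitCone 𝓒)
    {X : Matrix (Fin n) (Fin n) D} (hX : X ∈ 𝓒) (hXW : ∀ v, X *ᵥ v ∈ W)
    (h : ∃ w ∈ W, X *ᵥ w ≠ 0) :
    ∃ c > 0, ∃ᶠ m : ℕ in atTop, ∀ w ∈ W, c * (‖X ^ m‖ * ‖w‖) ≤ ‖(X ^ m) *ᵥ w‖ := by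
  obtain ⟨hinj, hsurj⟩ := hW.bijOn h𝓒 hX hXW h
  obtain ⟨w₀, hw₀, hne⟩ := h
  have hpow : ∀ m : ℕ, ‖X ^ (m + 1)‖ ≠ 0 := by
    intro m h0
    have : ∀ m : ℕ, (X ^ (m + 1)) *ᵥ w₀ ∈ W ∧ (X ^ (m + 1)) *ᵥ w₀ ≠ 0 := by
      intro m
      induction m with
      | zero => simpa using ⟨hXW _, hne⟩
      | succ m ih =>
        rw [pow_succ', ← Matrix.mulVec_mulVec]
        exact ⟨hXW _, fun h0 => ih.2 (hinj _ ih.1 h0)⟩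
    apply (this m).2
    rw [norm_eq_zero.1 h0, Matrix.zero_mulVec]
  -- Exponents start at one because the identity need not lie in the cone or map into $W$.
  let Y : ℕ → Matrix (Fin n) (Fin n) D := fun m => ‖X ^ (m + 1)‖⁻¹ • X ^ (m + 1)
  have : ProperSpace (Matrix (Fin n) (Fin n) D) := FiniteDimensional.proper ℝ _
  have hY : ∀ m, Y m ∈ Metric.sphere (0 : Matrix (Fin n) (Fin n) D) 1 := by
    intro m
    rw [mem_sphere_zero_iff_norm, norm_smul, norm_inv, norm_norm, inv_mul_cancel₀ (hpow m)]
  obtain ⟨Z, hZ, φ, hφ, hlim⟩ := (isCompact_sphere _ _).tendsto_subseq hY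
  have hZ𝓒 : Z ∈ 𝓒 := h𝓒.isClosed.mem_of_tendsto hlim
    (Eventually.of_forall fun k => h𝓒.smul_mem _ _ (h𝓒.pow_succ_mem hX _))
  have hlimv : ∀ v : Fin n → D, Tendsto (fun k => Y (φ k) *ᵥ v) atTop (𝓝 (Z *ᵥ v)) := by
    intro v
    have hc : Continuous fun A : Matrix (Fin n) (Fin n) D => A *ᵥ v :=
      continuous_id.matrix_mulVec continuous_const
    exact (hc.tendsto Z).comp hlim
  have hWc : IsClosed (W : Set (Fin n → D)) :=
    Submodule.closed_of_finiteDimensional (W.restrictScalars ℝ)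
  have hZW : ∀ v, Z *ᵥ v ∈ W := by
    intro v
    refine hWc.mem_of_tendsto (hlimv v) (Eventually.of_forall fun k => ?_)
    change (‖_‖⁻¹ • _) *ᵥ v ∈ W
    rw [Matrix.smul_mulVec, pow_succ', ← Matrix.mulVec_mulVec]
    exact real_smul_mem _ _ (hXW _)
  -- As $X$ maps $W$ onto $W$, each vector differs from one in $W$ by an element of $\ker X$, which
  -- $Z$ also kills. Vanishing on $W$ would give $Z=0$, against $\|Z\|=1$.
  have hZne : ∃ w ∈ W, Z *ᵥ w ≠ 0 := by
    by_contra! h0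
    have : Z = 0 := by
      refine Matrix.ext_of_mulVec_single fun i => ?_
      rw [Matrix.zero_mulVec]
      obtain ⟨w, hw, hXw⟩ := hsurj _ (hXW (Pi.single i 1))
      have hk : Z *ᵥ (Pi.single i 1 - w) = 0 := by
        refine tendsto_nhds_unique (hlimv _) (tendsto_const_nhds.congr fun k => ?_)
        change _ = (‖_‖⁻¹ • _) *ᵥ _
        rw [Matrix.smul_mulVec, pow_succ, ← Matrix.mulVec_mulVec, Matrix.mulVec_sub, hXw,
          sub_self, Matrix.mulVec_zero, smul_zero]
      rwa [Matrix.mulVec_sub, h0 w hw, sub_zero] at hk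
    simp [this] at hZ
  obtain ⟨hZinj, -⟩ := hW.bijOn h𝓒 hZ𝓒 hZW hZne
  let f : W.restrictScalars ℝ →ₗ[ℝ] (Fin n → D) :=
    (Matrix.mulVecBilin D ℝ Z).comp (W.restrictScalars ℝ).subtype
  obtain ⟨K, hK, hlip⟩ := f.exists_antilipschitzWith (by
    rw [LinearMap.ker_eq_bot']
    rintro ⟨w, hw⟩ h0
    exact Subtype.ext (hZinj w hw h0))
  have hK' : (0 : ℝ) < K := hK
  have hZlow : ∀ w ∈ W, ‖w‖ ≤ K * ‖Z *ᵥ w‖ := fun w hw =>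
    hlip.le_mul_norm f.map_zero ⟨w, hw⟩
  -- $Z$ expands by at least $1/K$ on $W$; an approximation within $1/(2K)$ keeps half of that.
  refine ⟨(2 * K)⁻¹, by positivity, ?_⟩
  have hev : ∀ᶠ k in atTop, ‖Y (φ k) - Z‖ < (2 * K : ℝ)⁻¹ :=
    (tendsto_iff_norm_sub_tendsto_zero.1 hlim).eventually_lt_const (by positivity)
  have ht : Tendsto (fun k => φ k + 1) atTop atTop :=
    (tendsto_add_atTop_nat 1).comp hφ.tendsto_atTop
  refine ht.frequently (Eventually.frequently (hev.mono fun k hk w hw => ?_))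
  have h1 : ‖(Y (φ k) - Z) *ᵥ w‖ ≤ (2 * K : ℝ)⁻¹ * ‖w‖ :=
    (Matrix.linfty_opNorm_mulVec _ _).trans (mul_le_mul_of_nonneg_right hk.le (norm_nonneg _))
  have h2 : ‖Z *ᵥ w‖ ≤ ‖Y (φ k) *ᵥ w‖ + ‖(Y (φ k) - Z) *ᵥ w‖ := by
    rw [Matrix.sub_mulVec]
    have := norm_sub_le (Y (φ k) *ᵥ w) (Y (φ k) *ᵥ w - Z *ᵥ w)
    simpa using this
  have h3 : (K : ℝ)⁻¹ * ‖w‖ ≤ ‖Z *ᵥ w‖ := by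
    rw [inv_mul_le_iff₀ hK']; exact hZlow w hw
  have h4 : (2 * K : ℝ)⁻¹ * ‖w‖ ≤ ‖Y (φ k) *ᵥ w‖ := by
    have : (K : ℝ)⁻¹ = (2 * K : ℝ)⁻¹ + (2 * K : ℝ)⁻¹ := by field_simp; norm_num
    rw [this, add_mul] at h3
    linarith
  have h5 : ‖Y (φ k) *ᵥ w‖ = ‖X ^ (φ k + 1)‖⁻¹ * ‖(X ^ (φ k + 1)) *ᵥ w‖ := by
    change ‖(‖_‖⁻¹ • _) *ᵥ w‖ = _
    rw [Matrix.smul_mulVec, norm_smul, norm_inv, norm_norm]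
  have hpos : 0 < ‖X ^ (φ k + 1)‖ := lt_of_le_of_ne (norm_nonneg _) (hpow _).symm
  rw [h5, le_inv_mul_iff₀ hpos] at h4
  linarith

theorem pow_mulVec_of_eigenvector {A : Matrix (Fin n) (Fin n) D} {a : ℝ} {v : Fin n → D}
    (h : A *ᵥ v = a • v) (m : ℕ) : (A ^ m) *ᵥ v = a ^ m • v := by
  induction m with
  | zero => simp
  | succ m ih =>
    rw [pow_succ, ← Matrix.mulVec_mulVec, h, Matrix.mulVec_smul, ih, smul_smul, pow_succ']

/-- The factor $a$ on the left avoids the exponent $m-1$. -/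
theorem pow_mulVec_of_jordan {A : Matrix (Fin n) (Fin n) D} {a : ℝ} {w u : Fin n → D}
    (hw : A *ᵥ w = a • w + u) (hu : A *ᵥ u = a • u) (m : ℕ) :
    a • ((A ^ m) *ᵥ w) = a ^ (m + 1) • w + (m * a ^ m) • u := by
  induction m with
  | zero => simp
  | succ m ih =>
    rw [pow_succ', ← Matrix.mulVec_mulVec, ← Matrix.mulVec_smul, ih, Matrix.mulVec_add,
      Matrix.mulVec_smul, Matrix.mulVec_smul, hw, hu]
    push_cast
    module

/-- By the lower bound on powers, any two eigenvalues of $X^2$ with eigenvectors of $X$ in $W$ grow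
at the same rate, so they agree. A nonzero $X^2-l^2$ on $W$ would yield a Jordan block, whose powers
grow like $m\,l^{2m}$, too fast for that bound. -/
theorem IsMinimalRange.exists_sq_eq_smul [FiniteDimensional ℝ D]
    (hW : IsMinimalRange 𝓒 W) (h𝓒 : IsSplitCone 𝓒)
    {X : Matrix (Fin n) (Fin n) D} (hX : X ∈ 𝓒) (hXW : ∀ v, X *ᵥ v ∈ W)
    (h : ∃ w ∈ W, X *ᵥ w ≠ 0) : ∃ a : ℝ, 0 < a ∧ ∀ w ∈ W, X *ᵥ (X *ᵥ w) = a • w := by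
  obtain ⟨hinj, -⟩ := hW.bijOn h𝓒 hX hXW h
  obtain ⟨w₀, hw₀, hne⟩ := h
  have hsq : ∀ v, (X * X) *ᵥ v = X *ᵥ (X *ᵥ v) := fun v => (Matrix.mulVec_mulVec _ _ _).symm
  obtain ⟨c, hc, hfreq⟩ := hW.frequently_le_norm_pow h𝓒 (h𝓒.mul_mem _ hX _ hX)
    (fun v => by rw [hsq]; exact hXW _)
    ⟨w₀, hw₀, fun h0 => hne (hinj _ (hXW _) (by rwa [hsq] at h0))⟩
  have heig : ∀ v ∈ W, v ≠ 0 → ∀ l : ℝ, X *ᵥ v = l • v →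
      0 < l ^ 2 ∧ (X * X) *ᵥ v = l ^ 2 • v ∧
        ∀ m : ℕ, (∀ w ∈ W, c * (‖(X * X) ^ m‖ * ‖w‖) ≤ ‖((X * X) ^ m) *ᵥ w‖) →
          c * ‖(X * X) ^ m‖ ≤ (l ^ 2) ^ m ∧ (l ^ 2) ^ m ≤ ‖(X * X) ^ m‖ := by
    intro v hv hv0 l hl
    have hl0 : l ≠ 0 := by
      rintro rfl
      exact hv0 (hinj v hv (by rw [hl, zero_smul]))
    have h2 : (X * X) *ᵥ v = l ^ 2 • v := by
      rw [hsq, hl, Matrix.mulVec_smul, hl, smul_smul, sq]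
    refine ⟨by positivity, h2, fun m hm => ?_⟩
    have hvpos : 0 < ‖v‖ := norm_pos_iff.2 hv0
    have hn : ‖((X * X) ^ m) *ᵥ v‖ = (l ^ 2) ^ m * ‖v‖ := by
      rw [pow_mulVec_of_eigenvector h2, norm_smul, Real.norm_of_nonneg (by positivity)]
    have h3 := hm v hv
    have h4 := Matrix.linfty_opNorm_mulVec ((X * X) ^ m) v
    rw [hn] at h3 h4
    rw [← mul_assoc] at h3
    exact ⟨le_of_mul_le_mul_right h3 hvpos, le_of_mul_le_mul_right h4 hvpos⟩
  obtain ⟨l, v, hv, hv0, hl⟩ := h𝓒.exists_eigenvector X hX (W.restrictScalars ℝ)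
    (fun u _ => hXW u) (X *ᵥ w₀) (hXW _) hne
  obtain ⟨ha, -, hva⟩ := heig v hv hv0 l hl
  refine ⟨l ^ 2, ha, ?_⟩
  by_contra! hcon
  obtain ⟨w₁, hw₁, hne₁⟩ := hcon
  let N : (Fin n → D) →ₗ[ℝ] (Fin n → D) := Matrix.mulVecBilin D ℝ (X * X) - l ^ 2 • LinearMap.id
  have hN : ∀ v, N v = (X * X) *ᵥ v - l ^ 2 • v := fun v => rfl
  obtain ⟨b, u, ⟨w, hw, rfl⟩, hu0, hu⟩ := h𝓒.exists_eigenvector X hX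
    ((W.restrictScalars ℝ).map N)
    (by
      rintro _ ⟨w, hw, rfl⟩
      refine ⟨X *ᵥ w, hXW w, ?_⟩
      rw [hN, hN, Matrix.mulVec_sub, hsq, hsq, Matrix.mulVec_smul])
    (N w₁) ⟨w₁, hw₁, rfl⟩ (by rw [hN, hsq]; exact sub_ne_zero.2 hne₁)
  have hwW : w ∈ W := hw
  have huW : N w ∈ W := by
    rw [hN, hsq]; exact W.sub_mem (hXW _) (real_smul_mem _ _ hwW)
  obtain ⟨hb, hub, hua⟩ := heig _ huW hu0 b hu
  have hab : b ^ 2 = l ^ 2 := by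
    refine le_antisymm (le_of_frequently_mul_pow_le hc ha (hfreq.mono fun m hm => ?_))
      (le_of_frequently_mul_pow_le hc hb (hfreq.mono fun m hm => ?_))
    · exact (mul_le_mul_of_nonneg_left (hua m hm).2 hc.le).trans (hva m hm).1
    · exact (mul_le_mul_of_nonneg_left (hva m hm).2 hc.le).trans (hua m hm).1
  rw [hab] at hub
  have hjor := pow_mulVec_of_jordan (A := X * X) (a := l ^ 2) (w := w) (u := N w)
    (by rw [hN]; abel) hub
  have hupos : 0 < ‖N w‖ := norm_pos_iff.2 hu0
  have hlarge : ∀ᶠ m : ℕ in atTop, l ^ 2 * (c⁻¹ * ‖w‖) + l ^ 2 * ‖w‖ < m * ‖N w‖ :=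
    (tendsto_natCast_atTop_atTop.atTop_mul_const hupos).eventually_gt_atTop _
  refine hfreq (hlarge.mono fun m hm hP => ?_)
  obtain ⟨h1, h2⟩ := hva m hP
  have hpos : 0 < (l ^ 2) ^ m := by positivity
  have h3 : ‖(m * (l ^ 2) ^ m) • N w‖ ≤
      ‖(l ^ 2) • (((X * X) ^ m) *ᵥ w)‖ + ‖(l ^ 2) ^ (m + 1) • w‖ := by
    rw [hjor m]
    have := norm_sub_le ((l ^ 2) ^ (m + 1) • w + (m * (l ^ 2) ^ m) • N w) ((l ^ 2) ^ (m + 1) • w)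
    simpa using this
  have h4 := Matrix.linfty_opNorm_mulVec ((X * X) ^ m) w
  rw [norm_smul, norm_smul, norm_smul, Real.norm_of_nonneg (by positivity),
    Real.norm_of_nonneg ha.le, Real.norm_of_nonneg (by positivity)] at h3
  have h5 : ‖(X * X) ^ m‖ ≤ c⁻¹ * (l ^ 2) ^ m := by
    rw [le_inv_mul_iff₀ hc]; exact h1
  have h6 : ‖((X * X) ^ m) *ᵥ w‖ ≤ c⁻¹ * (l ^ 2) ^ m * ‖w‖ :=
    h4.trans (mul_le_mul_of_nonneg_right h5 (norm_nonneg _))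
  have h7 := mul_le_mul_of_nonneg_left h6 ha.le
  have h8 := mul_lt_mul_of_pos_left hm hpos
  rw [pow_succ (l ^ 2) m] at h3
  linarith

/-- Members of the cone with values in a minimal range act on it as real scalars. -/
theorem IsMinimalRange.exists_eq_smul [FiniteDimensional ℝ D]
    (hW : IsMinimalRange 𝓒 W) (h𝓒 : IsSplitCone 𝓒)
    {X : Matrix (Fin n) (Fin n) D} (hX : X ∈ 𝓒) (hXW : ∀ v, X *ᵥ v ∈ W) :
    ∃ r : ℝ, ∀ w ∈ W, X *ᵥ w = r • w := by
  by_cases h : ∃ w ∈ W, X *ᵥ w ≠ 0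
  swap
  · push Not at h
    exact ⟨0, fun w hw => by rw [h w hw, zero_smul]⟩
  obtain ⟨hinj, -⟩ := hW.bijOn h𝓒 hX hXW h
  obtain ⟨a, ha, hXX⟩ := hW.exists_sq_eq_smul h𝓒 hX hXW h
  have hcomm : ∀ Y ∈ 𝓒, (∀ v, Y *ᵥ v ∈ W) → ∀ w ∈ W, Y *ᵥ (X *ᵥ w) = X *ᵥ (Y *ᵥ w) := by
    intro Y hY hYW
    by_cases h' : ∃ w ∈ W, Y *ᵥ w ≠ 0
    swap
    · push Not at h'
      intro w hw
      rw [h' w hw, h' _ (hXW w), Matrix.mulVec_zero]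
    obtain ⟨hinj', -⟩ := hW.bijOn h𝓒 hY hYW h'
    obtain ⟨b, hb, hYY⟩ := hW.exists_sq_eq_smul h𝓒 hY hYW h'
    obtain ⟨w₀, hw₀, hne⟩ := h'
    obtain ⟨d, hd, hXY⟩ := hW.exists_sq_eq_smul h𝓒 (h𝓒.mul_mem _ hX _ hY)
      (fun v => by rw [← Matrix.mulVec_mulVec]; exact hXW _)
      ⟨w₀, hw₀, fun h0 => hne (hinj _ (hYW _) (by rwa [← Matrix.mulVec_mulVec] at h0))⟩
    simp only [← Matrix.mulVec_mulVec] at hXY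
    -- Apply $XYXY=d$ to $Yw$, then multiply by $X$ on the left. Using the relation twice gives
    -- $(ab)^2=d^2$, and positivity excludes $ab=-d$.
    have h1 : ∀ w ∈ W, (a * b) • (Y *ᵥ (X *ᵥ w)) = d • (X *ᵥ (Y *ᵥ w)) := by
      intro w hw
      have h2 := congrArg (X *ᵥ ·) (hXY _ (hYW w))
      simp only [hYY w hw, Matrix.mulVec_smul] at h2
      rw [hXX _ (hYW _)] at h2
      rw [← h2, smul_comm, mul_smul, smul_comm]
    have h3 : (a * b) ^ 2 = d ^ 2 := by
      have h4 := h1 _ (hXW w₀)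
      rw [hXX w₀ hw₀, Matrix.mulVec_smul] at h4
      have h5 : (a * b) • (X *ᵥ (Y *ᵥ (X *ᵥ w₀))) = d • (a • (Y *ᵥ w₀)) := by
        rw [← Matrix.mulVec_smul, h1 w₀ hw₀, Matrix.mulVec_smul, hXX _ (hYW w₀)]
      have h6 : ((a * b) * ((a * b) * a)) • (Y *ᵥ w₀) = (d * (d * a)) • (Y *ᵥ w₀) := by
        rw [mul_smul, mul_smul (a * b) a, h4, smul_comm, h5, mul_smul, mul_smul]
      have h7 := smul_left_injective ℝ hne h6
      have h8 : a * (a * b) ^ 2 = a * d ^ 2 := by linarith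
      exact mul_left_cancel₀ ha.ne' h8
    have h4 : a * b = d := (pow_left_inj₀ (by positivity) hd.le two_ne_zero).1 h3
    intro w hw
    have h5 := h1 w hw
    rw [h4] at h5
    exact smul_right_injective _ hd.ne' h5
  obtain ⟨w₀, hw₀, hne⟩ := h
  obtain ⟨l, v, hv, hv0, hl⟩ := h𝓒.exists_eigenvector X hX (W.restrictScalars ℝ)
    (fun u _ => hXW u) (X *ᵥ w₀) (hXW _) hne
  obtain ⟨T, hT, hTW⟩ := hW.exists_range_eq
  have hTm : ∀ v, T *ᵥ v ∈ W := fun v => hTW ▸ ⟨v, rfl⟩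
  -- For an eigenvector $v\in W$, commutation gives $XTAv=TAXv=l\,TAv$, and the vectors $Av$ span.
  have hle : (⊤ : Submodule Dᵐᵒᵖ (Fin n → D)) ≤
      (mulVecOp ((X - l • (1 : Matrix (Fin n) (Fin n) D)) * T)).ker := by
    rw [← h𝓒.span_eq_top v hv0, Submodule.span_le]
    rintro _ ⟨A, hA, rfl⟩
    have := hcomm (T * A) (h𝓒.mul_mem _ hT _ hA)
      (fun v => by rw [← Matrix.mulVec_mulVec]; exact hTm _) v hv
    rw [hl, Matrix.mulVec_smul, ← Matrix.mulVec_mulVec] at this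
    change ((X - l • (1 : Matrix (Fin n) (Fin n) D)) * T) *ᵥ (A *ᵥ v) = 0
    rw [← Matrix.mulVec_mulVec, Matrix.sub_mulVec, Matrix.smul_mulVec, Matrix.one_mulVec, ← this,
      sub_self]
  refine ⟨l, fun w hw => ?_⟩
  rw [← hTW] at hw
  obtain ⟨u, rfl⟩ := hw
  have : ((X - l • (1 : Matrix (Fin n) (Fin n) D)) * T) *ᵥ u = 0 := hle (Submodule.mem_top (x := u))
  rw [← Matrix.mulVec_mulVec, Matrix.sub_mulVec, Matrix.smul_mulVec, Matrix.one_mulVec,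
    sub_eq_zero] at this
  exact this

/-- The cone contains an idempotent of rank one whose corner consists of real scalars. -/
theorem IsSplitCone.exists_rank_one [FiniteDimensional ℝ D] (h𝓒 : IsSplitCone 𝓒) (hn : 0 < n) :
    ∃ E ∈ 𝓒, ∃ x : Fin n → D, x ≠ 0 ∧ E *ᵥ x = x ∧ (∀ v, ∃ d : D, E *ᵥ v = op d • x) ∧
      ∀ B ∈ 𝓒, ∃ r : ℝ, E *ᵥ (B *ᵥ x) = r • x := by
  obtain ⟨W, hW⟩ := h𝓒.exists_isMinimalRange hn
  obtain ⟨T, hT, hTW⟩ := hW.exists_range_eq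
  obtain ⟨x, hx, hx0⟩ := Submodule.exists_mem_ne_zero_of_ne_bot hW.ne_bot
  have hTm : ∀ v, T *ᵥ v ∈ W := fun v => hTW ▸ ⟨v, rfl⟩
  have hT0 : T ≠ 0 := by
    rintro rfl
    rw [← hTW] at hx
    obtain ⟨u, rfl⟩ := hx
    exact hx0 (Matrix.zero_mulVec u) |>.elim
  have hscal : ∀ B ∈ 𝓒, ∃ r : ℝ, ∀ w ∈ W, T *ᵥ (B *ᵥ w) = r • w := by
    intro B hB
    simpa only [Matrix.mulVec_mulVec] using hW.exists_eq_smul h𝓒 (h𝓒.mul_mem _ hT _ hB)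
      (fun v => by rw [← Matrix.mulVec_mulVec]; exact hTm _)
  have hline : ∀ v, ∃ d : D, T *ᵥ v = op d • x := by
    have hle : (⊤ : Submodule Dᵐᵒᵖ (Fin n → D)) ≤
        (Submodule.span Dᵐᵒᵖ {x}).comap (mulVecOp T) := by
      rw [← h𝓒.span_eq_top x hx0, Submodule.span_le]
      rintro _ ⟨A, hA, rfl⟩
      obtain ⟨r, hr⟩ := hscal A hA
      change T *ᵥ (A *ᵥ x) ∈ Submodule.span Dᵐᵒᵖ {x}
      rw [hr x hx]
      exact real_smul_mem _ _ (Submodule.mem_span_singleton_self x)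
    intro v
    obtain ⟨c, hc⟩ := Submodule.mem_span_singleton.1 (hle (Submodule.mem_top (x := v)))
    exact ⟨unop c, hc.symm⟩
  obtain ⟨A, hA, hne⟩ := h𝓒.exists_mulVec_ne_zero hT0 hx0
  obtain ⟨r, hr⟩ := hscal A hA
  have hr0 : r ≠ 0 := by
    rintro rfl
    exact hne (by rw [hr x hx, zero_smul])
  have hE : ∀ v, (r⁻¹ • (T * A)) *ᵥ v = r⁻¹ • (T *ᵥ (A *ᵥ v)) := fun v => by
    rw [Matrix.smul_mulVec, Matrix.mulVec_mulVec]
  refine ⟨r⁻¹ • (T * A), h𝓒.smul_mem _ _ (h𝓒.mul_mem _ hT _ hA), x, hx0, ?_, fun v => ?_,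
    fun B hB => ?_⟩
  · rw [hE, hr x hx, inv_smul_smul₀ hr0]
  · obtain ⟨d, hd⟩ := hline (A *ᵥ v)
    rw [hE, hd]
    exact ⟨d * algebraMap ℝ D r⁻¹, by rw [op_mul, mul_smul, op_smul_algebraMap]⟩
  · obtain ⟨s, hs⟩ := hscal (A * B) (h𝓒.mul_mem _ hA _ hB)
    have := hs x hx
    rw [← Matrix.mulVec_mulVec] at this
    exact ⟨r⁻¹ * s, by rw [hE, this, smul_smul]⟩

end Analysis

/-- The trace is the sum of the complex characteristic roots, each of which is some $l_i$. -/
theorem trace_mem_of_aeval_prod {V : Type*} [AddCommGroup V] [Module ℝ V] [FiniteDimensional ℝ V]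
    {F : Subfield ℝ} {ι : Type*} [Fintype ι] {l : ι → ℝ} (hl : ∀ i, l i ∈ F)
    {f : Module.End ℝ V} (h : aeval f (∏ i, (X - C (l i))) = 0) : LinearMap.trace ℝ V f ∈ F := by
  classical
  let b := Module.finBasis ℝ V
  let N := LinearMap.toMatrixAlgEquiv b f
  let M := (Algebra.ofId ℝ ℂ).mapMatrix N
  have hM : aeval M ((∏ i, (X - C (l i))).map (algebraMap ℝ ℂ)) = 0 := by
    rw [aeval_map_algebraMap, aeval_algHom_apply, aeval_algHom_apply, h, map_zero, map_zero]
  have hroots : ∀ μ ∈ M.charpoly.roots, ∃ c ∈ F, (c : ℂ) = μ := by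
    intro μ hμ
    have hspec := Matrix.mem_spectrum_of_isRoot_charpoly (isRoot_of_mem_roots hμ)
    have h1 := spectrum.subset_polynomial_aeval M ((∏ i, (X - C (l i))).map (algebraMap ℝ ℂ))
      ⟨μ, hspec, rfl⟩
    have : Nontrivial (Matrix (Fin (Module.finrank ℝ V)) (Fin (Module.finrank ℝ V)) ℂ) := by
      by_contra hnt
      rw [not_nontrivial_iff_subsingleton] at hnt
      rw [spectrum.of_subsingleton] at hspec
      exact hspec
    rw [hM, spectrum.zero_eq, Set.mem_singleton_iff] at h1
    simp only [Polynomial.map_prod, Polynomial.map_sub, map_X, map_C, eval_prod, eval_sub, eval_X,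
      eval_C, Finset.prod_eq_zero_iff] at h1
    obtain ⟨i, -, hi⟩ := h1
    exact ⟨l i, hl i, (sub_eq_zero.1 hi).symm⟩
  have htr : ((LinearMap.trace ℝ V f : ℝ) : ℂ) = M.charpoly.roots.sum := by
    rw [← Matrix.trace_eq_sum_roots_charpoly, LinearMap.trace_eq_matrix_trace ℝ b]
    simp [M, N, Matrix.trace]
    rfl
  have hsum : ∀ s : Multiset ℂ, (∀ μ ∈ s, ∃ c ∈ F, (c : ℂ) = μ) → ∃ c ∈ F, (c : ℂ) = s.sum := by
    intro s
    induction s using Multiset.induction_on with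
    | empty => exact fun _ => ⟨0, F.zero_mem, by simp⟩
    | cons a s ih =>
      intro hs
      obtain ⟨c, hc, rfl⟩ := hs a (Multiset.mem_cons_self _ _)
      obtain ⟨d, hd, hds⟩ := ih fun μ hμ => hs μ (Multiset.mem_cons_of_mem hμ)
      exact ⟨c + d, F.add_mem hc hd, by rw [Multiset.sum_cons, ← hds]; push_cast; rfl⟩
  obtain ⟨c, hc, hcs⟩ := hsum _ hroots
  rw [← htr] at hcs
  rwa [← Complex.ofReal_injective hcs]

/-! ### Descent from the cone to the algebra over `F`. -/

section

variable {D : Type*} [NormedDivisionRing D] [NormedAlgebra ℝ D] {n : ℕ}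

/-- Matrices acting on columns, as an algebra of real linear maps. -/
noncomputable def mulVecAlgHom : Matrix (Fin n) (Fin n) D →ₐ[ℝ] Module.End ℝ (Fin n → D) :=
  AlgHom.ofLinearMap
    { toFun := fun A => Matrix.mulVecBilin D ℝ A
      map_add' := fun A B => LinearMap.ext fun v => Matrix.add_mulVec A B v
      map_smul' := fun r A => LinearMap.ext fun v => Matrix.smul_mulVec r A v }
    (LinearMap.ext fun v => Matrix.one_mulVec v)
    (fun A B => LinearMap.ext fun v => (Matrix.mulVec_mulVec v A B).symm)

theorem trace_mulVecAlgHom_vecMulVec [FiniteDimensional ℝ D] {y t : Fin n → D} {r : ℝ}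
    (h : t ⬝ᵥ y = algebraMap ℝ D r) :
    LinearMap.trace ℝ (Fin n → D) (mulVecAlgHom (Matrix.vecMulVec y t)) =
      r * Module.finrank ℝ D := by
  let f : (Fin n → D) →ₗ[ℝ] D :=
    { toFun := fun v => t ⬝ᵥ v
      map_add' := fun v w => dotProduct_add _ _ _
      map_smul' := fun c v => dotProduct_smul _ _ _ }
  let g : D →ₗ[ℝ] (Fin n → D) :=
    { toFun := fun d => op d • y
      map_add' := fun c d => by rw [op_add, add_smul]
      map_smul' := fun c d => by ext i; simp }
  have h1 : mulVecAlgHom (Matrix.vecMulVec y t) = g ∘ₗ f := by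
    exact LinearMap.ext fun v => Matrix.vecMulVec_mulVec y t v
  have h2 : f ∘ₗ g = r • LinearMap.id := by
    ext d
    change t ⬝ᵥ (op d • y) = r • d
    rw [dotProduct_smul, h, op_smul_eq_mul, ← Algebra.smul_def]
  rw [h1, LinearMap.trace_comp_comm', h2, map_smul, LinearMap.trace_id, smul_eq_mul]

theorem aeval_mulVec_of_eigenvector {A : Matrix (Fin n) (Fin n) D} {c : ℝ} {v : Fin n → D}
    (h : A *ᵥ v = c • v) (p : ℝ[X]) : aeval A p *ᵥ v = p.eval c • v := by
  induction p using Polynomial.induction_on' with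
  | add p q hp hq => rw [map_add, Matrix.add_mulVec, hp, hq, eval_add, add_smul]
  | monomial m a =>
    rw [aeval_monomial, ← Matrix.mulVec_mulVec, pow_mulVec_of_eigenvector h, algebraMap_mulVec,
      eval_monomial, smul_smul]

theorem algGen_induction {F : Subfield ℝ} {S : Subsemigroup (Matrix (Fin n) (Fin n) D)}
    {p : Matrix (Fin n) (Fin n) D → Prop} (mem : ∀ A ∈ S, p A) (zero : p 0)
    (add : ∀ A B, p A → p B → p (A + B)) (smul : ∀ c ∈ F, ∀ A, p A → p (c • A))
    {A : Matrix (Fin n) (Fin n) D}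
    (hA : A ∈ algGen F (S : Set (Matrix (Fin n) (Fin n) D))) : p A := by
  have h : A ∈ Submodule.span F (S : Set (Matrix (Fin n) (Fin n) D)) := by
    rw [← algGen_eq_span]; exact hA
  clear hA
  induction h using Submodule.span_induction with
  | mem A hA => exact mem A hA
  | zero => exact zero
  | add A B _ _ h1 h2 => exact add A B h1 h2
  | smul c A _ h1 => exact smul c c.2 A h1

theorem smul_mem_algGen {F : Subfield ℝ} {𝓢 : Set (Matrix (Fin n) (Fin n) D)} {c : ℝ} (hc : c ∈ F)
    {A : Matrix (Fin n) (Fin n) D} (hA : A ∈ algGen F 𝓢) : c • A ∈ algGen F 𝓢 :=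
  (algGen F 𝓢).toSubmodule.smul_mem (⟨c, hc⟩ : F) hA

/-- The extra factor $A$ removes the constant term, as the algebra need not be unital. -/
theorem mul_aeval_prod_mem_algGen {F : Subfield ℝ} {𝓢 : Set (Matrix (Fin n) (Fin n) D)}
    {A : Matrix (Fin n) (Fin n) D} (hA : A ∈ 𝓢) {ι : Type*} {l : ι → ℝ} (hl : ∀ i, l i ∈ F)
    (J : Finset ι) : A * aeval A (∏ i ∈ J, (X - C (l i))) ∈ algGen F 𝓢 := by
  classical
  have hA' : A ∈ algGen F 𝓢 := NonUnitalAlgebra.subset_adjoin F hA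
  induction J using Finset.induction_on with
  | empty => simpa using hA'
  | insert i J hi ih =>
    have : A * aeval A (∏ i ∈ insert i J, (X - C (l i))) =
        A * (A * aeval A (∏ i ∈ J, (X - C (l i)))) -
          l i • (A * aeval A (∏ i ∈ J, (X - C (l i)))) := by
      rw [Finset.prod_insert hi, map_mul, map_sub, aeval_X, aeval_C, sub_mul, mul_sub,
        ← Algebra.smul_def, mul_smul_comm]
    rw [this]
    exact sub_mem (mul_mem hA' ih) (smul_mem_algGen (hl i) ih)

/-- If the closed cone over `S` contains an idempotent of rank one, then the algebra generated by
`S` over the field that contains the spectra contains a matrix of rank one. -/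
theorem exists_vecMulVec_mem_algGen {F : Subfield ℝ} {𝓢 : Set (Matrix (Fin n) (Fin n) D)}
    (h𝓢 : ∀ A ∈ 𝓢, ∃ l : Fin n → ℝ, (∀ i, l i ∈ F) ∧ (∀ i, ∃ y, y ≠ 0 ∧ A *ᵥ y = l i • y) ∧
      aeval A (∏ i, (X - C (l i))) = 0)
    {E : Matrix (Fin n) (Fin n) D} (hE : E ∈ realCone 𝓢) {x : Fin n → D} (hx : x ≠ 0)
    (hEx : E *ᵥ x = x) (hline : ∀ v, ∃ d : D, E *ᵥ v = op d • x) :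
    ∃ y t : Fin n → D, y ≠ 0 ∧ t ≠ 0 ∧ Matrix.vecMulVec y t ∈ algGen F 𝓢 := by
  classical
  obtain ⟨r, A, l, a, hA, hlF, h0, hlim, ha⟩ := exists_seq_of_mem_realCone h𝓢 hE
  -- The roots outside $J$ are those whose scaled values tend to $0$; $T$ below removes them from
  -- $A_k$.
  let J : Finset (Fin n) := Finset.univ.filter fun i => a i ≠ 0
  let s : ℕ → Matrix (Fin n) (Fin n) D := fun k =>
    aeval (r k • A k) (∏ i ∈ Jᶜ, (X - C (r k * l k i)))
  let q : ℕ → Matrix (Fin n) (Fin n) D := fun k =>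
    aeval (r k • A k) (∏ i ∈ J, (X - C (r k * l k i)))
  have hs : Tendsto (fun k => (r k • A k) * s k) atTop
      (𝓝 (E * aeval E (∏ i ∈ Jᶜ, (X - C (a i))))) := hlim.mul (tendsto_aeval_prod hlim ha _)
  have hq : Tendsto q atTop (𝓝 (aeval E (∏ i ∈ J, (X - C (a i))))) :=
    tendsto_aeval_prod hlim ha _
  have hsne : E * aeval E (∏ i ∈ Jᶜ, (X - C (a i))) ≠ 0 := by
    intro hz
    have h1 : (E * aeval E (∏ i ∈ Jᶜ, (X - C (a i)))) *ᵥ x = x := by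
      rw [← Matrix.mulVec_mulVec,
        aeval_mulVec_of_eigenvector (c := 1) (by rw [hEx, one_smul]), Finset.prod_congr rfl
          (g := fun _ => (X : ℝ[X])) (fun i hi => by
            have : a i = 0 := by simpa [J] using hi
            rw [this, C_0, sub_zero])]
      simp [hEx]
    rw [hz, Matrix.zero_mulVec] at h1
    exact hx h1.symm
  obtain ⟨κ, hκ⟩ : ∃ κ : ℝ, κ = (∏ i ∈ J, (X - C (a i))).eval 0 := ⟨_, rfl⟩
  have hκ0 : κ ≠ 0 := by
    rw [hκ, eval_prod, Finset.prod_ne_zero_iff]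
    intro i hi
    simpa [J] using hi
  obtain ⟨k, hk1, hk2⟩ := ((hs.eventually_ne hsne).and
    ((tendsto_iff_norm_sub_tendsto_zero.1 hq).eventually_lt_const (abs_pos.2 hκ0))).exists
  obtain ⟨T, hT⟩ : ∃ T, T = A k * aeval (A k) (∏ i ∈ Jᶜ, (X - C (l k i))) := ⟨_, rfl⟩
  have hTmem : T ∈ algGen F 𝓢 := hT ▸ mul_aeval_prod_mem_algGen (hA k) (hlF k) _
  have hT0 : T ≠ 0 := by
    intro hz
    apply hk1
    simp only [s]
    rw [aeval_smul_prod, smul_mul_smul_comm, ← hT, hz, smul_zero]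
  have hqT : q k * T = 0 := by
    simp only [q]
    rw [aeval_smul_prod, hT, smul_mul_assoc]
    have : aeval (A k) (∏ i ∈ J, (X - C (l k i))) *
        (A k * aeval (A k) (∏ i ∈ Jᶜ, (X - C (l k i)))) = 0 := by
      nth_rw 2 [← aeval_X (R := ℝ) (A k)]
      rw [← map_mul, ← map_mul, mul_left_comm, Finset.prod_mul_prod_compl, map_mul, h0, mul_zero]
    rw [this, smul_zero]
  -- On $\ker E$ the limit of $q_k$ acts as $\kappa\ne0$, while $q_k$ kills the range of $T$; the
  -- two differ by less than $|\kappa|$ in norm. So $E$ embeds the range of $T$ in a line.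
  have hinj : ∀ v, E *ᵥ (T *ᵥ v) = 0 → T *ᵥ v = 0 := by
    intro v hv
    by_contra hne
    have h1 := aeval_mulVec_of_eigenvector (c := 0) (by rw [hv, zero_smul])
      (∏ i ∈ J, (X - C (a i)))
    rw [← hκ] at h1
    have h2 : (q k - aeval E (∏ i ∈ J, (X - C (a i)))) *ᵥ (T *ᵥ v) = -(κ • (T *ᵥ v)) := by
      rw [Matrix.sub_mulVec, h1, Matrix.mulVec_mulVec, hqT, Matrix.zero_mulVec, zero_sub]
    have h3 := Matrix.linfty_opNorm_mulVec (q k - aeval E (∏ i ∈ J, (X - C (a i)))) (T *ᵥ v)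
    rw [h2, norm_neg, norm_smul, Real.norm_eq_abs] at h3
    exact absurd (le_of_mul_le_mul_right h3 (norm_pos_iff.2 hne)) (not_le.2 hk2)
  obtain ⟨v, hv⟩ : ∃ v, T *ᵥ v ≠ 0 := by
    by_contra! h
    exact hT0 (Matrix.ext_of_mulVec_single fun i => by rw [h, Matrix.zero_mulVec])
  obtain ⟨d, hd⟩ := hline (T *ᵥ v)
  have hd0 : d ≠ 0 := by
    rintro rfl
    exact hv (hinj v (by rw [hd, op_zero, zero_smul]))
  have hTline : ∀ w, ∃ e : D, T *ᵥ w = op e • (T *ᵥ v) := by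
    intro w
    obtain ⟨e, he⟩ := hline (T *ᵥ w)
    refine ⟨d⁻¹ * e, ?_⟩
    have := hinj (w - op (d⁻¹ * e) • v) (by
      rw [Matrix.mulVec_sub, Matrix.mulVec_sub, Matrix.mulVec_smul, Matrix.mulVec_smul, he, hd,
        smul_smul, ← op_mul, mul_inv_cancel_left₀ hd0, sub_self])
    rwa [Matrix.mulVec_sub, Matrix.mulVec_smul, sub_eq_zero] at this
  choose t ht using fun j => hTline (Pi.single j 1)
  have hTvec : T = Matrix.vecMulVec (T *ᵥ v) t := by
    ext i j
    have := congrFun (ht j) i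
    rwa [Matrix.mulVec_single_one] at this
  refine ⟨T *ᵥ v, t, hv, ?_, hTvec ▸ hTmem⟩
  rintro rfl
  exact hT0 (by rw [hTvec, Matrix.vecMulVec_zero])

/-- Over a rank-one idempotent whose corner is real, a matrix of rank one in the generated algebra
can be factored so that its corner is real as well. -/
theorem exists_vecMulVec_corner_real {F : Subfield ℝ}
    {S : Subsemigroup (Matrix (Fin n) (Fin n) D)}
    (hirr : IsIrreducible (S : Set (Matrix (Fin n) (Fin n) D)))
    {E : Matrix (Fin n) (Fin n) D} {x : Fin n → D} (hx : x ≠ 0)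
    (hEx : E *ᵥ x = x) (hline : ∀ v, ∃ d : D, E *ᵥ v = op d • x)
    (hreal : ∀ B ∈ S, ∃ r : ℝ, E *ᵥ (B *ᵥ x) = r • x)
    {y t : Fin n → D} (hy : y ≠ 0) (ht : t ≠ 0)
    (hT : Matrix.vecMulVec y t ∈ algGen F (S : Set (Matrix (Fin n) (Fin n) D))) :
    ∃ y' t' : Fin n → D, y' ≠ 0 ∧ t' ≠ 0 ∧
      Matrix.vecMulVec y' t' ∈ algGen F (S : Set (Matrix (Fin n) (Fin n) D)) ∧
      ∀ B ∈ algGen F (S : Set (Matrix (Fin n) (Fin n) D)),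
        ∃ r : ℝ, t' ⬝ᵥ (B *ᵥ y') = algebraMap ℝ D r := by
  have hmem : ∀ B ∈ S, B ∈ algGen F (S : Set (Matrix (Fin n) (Fin n) D)) := fun B hB =>
    NonUnitalAlgebra.subset_adjoin F hB
  have hreal' : ∀ B ∈ algGen F (S : Set (Matrix (Fin n) (Fin n) D)), ∃ r : ℝ,
      E *ᵥ (B *ᵥ x) = r • x := by
    intro B hB
    refine algGen_induction (p := fun B => ∃ r : ℝ, E *ᵥ (B *ᵥ x) = r • x) hreal ?_ ?_ ?_ hB
    · exact ⟨0, by rw [Matrix.zero_mulVec, Matrix.mulVec_zero, zero_smul]⟩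
    · rintro A B ⟨r, hr⟩ ⟨s, hs⟩
      exact ⟨r + s, by rw [Matrix.add_mulVec, Matrix.mulVec_add, hr, hs, add_smul]⟩
    · rintro c - A ⟨r, hr⟩
      exact ⟨c * r, by rw [Matrix.smul_mulVec, Matrix.mulVec_smul, hr, smul_smul]⟩
  have hE0 : E ≠ 0 := by
    rintro rfl
    exact hx (by rw [← hEx, Matrix.zero_mulVec])
  obtain ⟨A₁, hA₁, h₁⟩ := hirr.exists_mulVec_ne_zero hE0 hy
  obtain ⟨A₂, hA₂, h₂⟩ := hirr.exists_mulVec_ne_zero (Matrix.vecMulVec_ne_zero hy ht) hx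
  obtain ⟨α, hα⟩ := hline (A₁ *ᵥ y)
  obtain ⟨β, hβ⟩ : ∃ β, β = t ⬝ᵥ (A₂ *ᵥ x) := ⟨_, rfl⟩
  have hα0 : α ≠ 0 := by
    rintro rfl
    exact h₁ (by rw [hα, op_zero, zero_smul])
  rw [Matrix.vecMulVec_mulVec, ← hβ] at h₂
  have hβ0 : β ≠ 0 := by
    rintro rfl
    exact h₂ (by rw [op_zero, zero_smul])
  have hcancel : ∀ (d : D) (r : ℝ), op d • x = r • x → d = algebraMap ℝ D r := by
    intro d r h
    rw [← op_smul_algebraMap] at h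
    exact op_injective (smul_left_injective Dᵐᵒᵖ hx h)
  have hβα : ∃ r : ℝ, α * β = algebraMap ℝ D r := by
    obtain ⟨r, hr⟩ := hreal' (A₁ * (Matrix.vecMulVec y t * A₂))
      (mul_mem (hmem _ hA₁) (mul_mem hT (hmem _ hA₂)))
    refine ⟨r, hcancel _ _ ?_⟩
    rw [← hr, ← Matrix.mulVec_mulVec, ← Matrix.mulVec_mulVec, Matrix.vecMulVec_mulVec, ← hβ,
      Matrix.mulVec_smul, Matrix.mulVec_smul, hα, op_mul, mul_smul]
  -- The product $yt$ is unchanged, and the new corner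
  -- $\alpha(tBy)\alpha^{-1}=(\alpha(tBy)\beta)(\alpha\beta)^{-1}$ is a quotient of reals.
  refine ⟨op α⁻¹ • y, α • t, ?_, ?_, ?_, fun B hB => ?_⟩
  · exact smul_ne_zero (op_ne_zero_iff _ |>.2 (inv_ne_zero hα0)) hy
  · exact smul_ne_zero hα0 ht
  · convert hT using 1
    ext i j
    simp [Matrix.vecMulVec_apply, mul_assoc, inv_mul_cancel_left₀ hα0]
  · obtain ⟨s, hs⟩ := hβα
    obtain ⟨r, hr⟩ := hreal' (A₁ * (Matrix.vecMulVec y t * (B * (Matrix.vecMulVec y t * A₂))))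
      (mul_mem (hmem _ hA₁) (mul_mem hT (mul_mem hB (mul_mem hT (hmem _ hA₂)))))
    have h3 : α * (t ⬝ᵥ (B *ᵥ y)) * β = algebraMap ℝ D r := by
      refine hcancel _ _ ?_
      rw [← hr]
      simp only [← Matrix.mulVec_mulVec, Matrix.vecMulVec_mulVec, ← hβ, Matrix.mulVec_smul,
        hα, op_mul, mul_smul]
    refine ⟨r * s⁻¹, ?_⟩
    rw [Matrix.mulVec_smul, dotProduct_smul, smul_dotProduct, map_mul, map_inv₀, ← hs, ← h3,
      mul_inv_rev, op_smul_eq_mul, smul_eq_mul, mul_assoc _ β, mul_inv_cancel_left₀ hβ0]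

theorem trace_mem_of_mem_algGen [FiniteDimensional ℝ D] {F : Subfield ℝ}
    {S : Subsemigroup (Matrix (Fin n) (Fin n) D)}
    (hS : ∀ A ∈ S, ∃ l : Fin n → ℝ, (∀ i, l i ∈ F) ∧ aeval A (∏ i, (X - C (l i))) = 0)
    {A : Matrix (Fin n) (Fin n) D}
    (hA : A ∈ algGen F (S : Set (Matrix (Fin n) (Fin n) D))) :
    LinearMap.trace ℝ (Fin n → D) (mulVecAlgHom A) ∈ F := by
  refine algGen_induction (p := fun A => LinearMap.trace ℝ (Fin n → D) (mulVecAlgHom A) ∈ F)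
    (fun A hA => ?_) ?_ (fun A B hA hB => ?_) (fun c hc A hA => ?_) hA
  · obtain ⟨l, hl, h0⟩ := hS A hA
    exact trace_mem_of_aeval_prod hl (by rw [aeval_algHom_apply, h0, map_zero])
  · rw [map_zero, map_zero]; exact F.zero_mem
  · rw [map_add, map_add]; exact F.add_mem hA hB
  · rw [map_smul, map_smul]; exact F.mul_mem hc hA

/-- The real trace of $ytB$ is $r\dim_{\mathbb R}D$, and real traces on the algebra lie in $F$. The
real trace is used because it stays additive and cyclic when $D$ is noncommutative. -/
theorem corner_mem_of_real [FiniteDimensional ℝ D] {F : Subfield ℝ}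
    {S : Subsemigroup (Matrix (Fin n) (Fin n) D)}
    (hS : ∀ A ∈ S, ∃ l : Fin n → ℝ, (∀ i, l i ∈ F) ∧ aeval A (∏ i, (X - C (l i))) = 0)
    {y t : Fin n → D}
    (hT : Matrix.vecMulVec y t ∈ algGen F (S : Set (Matrix (Fin n) (Fin n) D)))
    {B : Matrix (Fin n) (Fin n) D} (hB : B ∈ algGen F (S : Set (Matrix (Fin n) (Fin n) D)))
    {r : ℝ} (hr : t ⬝ᵥ (B *ᵥ y) = algebraMap ℝ D r) : r ∈ F := by
  have h := trace_mem_of_mem_algGen hS (mul_mem hT hB)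
  rw [Matrix.vecMulVec_mul,
    trace_mulVecAlgHom_vecMulVec (by rw [← Matrix.dotProduct_mulVec]; exact hr)] at h
  have hd : (Module.finrank ℝ D : ℝ) ≠ 0 := Nat.cast_ne_zero.2 Module.finrank_pos.ne'
  have := F.mul_mem h (F.inv_mem (natCast_mem F (Module.finrank ℝ D)))
  rwa [mul_inv_cancel_right₀ hd] at this

/-- An irreducible semigroup whose generated `F`-algebra contains a matrix of rank one with corner
in `F` generates, up to similarity, the full matrix algebra over `F`. -/
theorem isSimilar_matricesOver_of_rank_one {F : Subfield ℝ}
    {S : Subsemigroup (Matrix (Fin n) (Fin n) D)}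
    (hirr : IsIrreducible (S : Set (Matrix (Fin n) (Fin n) D)))
    {y t : Fin n → D} (hy : y ≠ 0) (ht : t ≠ 0)
    (hT : Matrix.vecMulVec y t ∈ algGen F (S : Set (Matrix (Fin n) (Fin n) D)))
    (hF : ∀ B ∈ algGen F (S : Set (Matrix (Fin n) (Fin n) D)),
      ∃ r ∈ F, t ⬝ᵥ (B *ᵥ y) = algebraMap ℝ D r) :
    IsSimilar (algGen F (S : Set (Matrix (Fin n) (Fin n) D)) : Set (Matrix (Fin n) (Fin n) D))
      (matricesOver D n F) := by
  have hmem : ∀ B ∈ S, B ∈ algGen F (S : Set (Matrix (Fin n) (Fin n) D)) := fun B hB =>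
    NonUnitalAlgebra.subset_adjoin F hB
  obtain ⟨x, hxS, hxi⟩ : ∃ x : Fin n → (Fin n → D), (∀ i, ∃ A ∈ S, A *ᵥ y = x i) ∧
      LinearIndependent Dᵐᵒᵖ x := by
    obtain ⟨f, hf, -, hfi⟩ := Submodule.exists_fun_fin_finrank_span_eq Dᵐᵒᵖ
      ((fun A : Matrix (Fin n) (Fin n) D => A *ᵥ y) '' (S : Set (Matrix (Fin n) (Fin n) D)))
    have h := hirr y hy
    rw [Subsemigroup.closure_eq] at h
    have hn : n = Module.finrank Dᵐᵒᵖ (Submodule.span Dᵐᵒᵖ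
        ((fun A : Matrix (Fin n) (Fin n) D => A *ᵥ y) ''
          (S : Set (Matrix (Fin n) (Fin n) D)))) := by
      rw [h, finrank_top, finrank_op_pi]
    exact ⟨f ∘ Fin.cast hn, fun i => hf _, hfi.comp _ (Fin.cast_injective hn)⟩
  choose A hAS hAx using hxS
  let R : Submodule F (Fin n → F) :=
    { carrier := {c | ∃ G ∈ algGen F (S : Set (Matrix (Fin n) (Fin n) D)),
        ∀ i, t ⬝ᵥ (G *ᵥ x i) = algebraMap ℝ D (c i)}
      zero_mem' := ⟨0, zero_mem _, fun i => by simp⟩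
      add_mem' := by
        rintro c d ⟨G, hG, hc⟩ ⟨H, hH, hd⟩
        exact ⟨G + H, add_mem hG hH, fun i => by
          rw [Matrix.add_mulVec, dotProduct_add, hc, hd]; simp⟩
      smul_mem' := by
        rintro a c ⟨G, hG, hc⟩
        exact ⟨(a : ℝ) • G, smul_mem_algGen a.2 hG, fun i => by
          rw [Matrix.smul_mulVec, dotProduct_smul, hc, Algebra.smul_def]; simp⟩ }
  -- A functional $f\neq0$ killing $R$ gives $z=\sum x_if_i$ with $tGz=0$ for all $G\in S$.
  -- Irreducibility forces $z=0$, contradicting independence of the $x_i$.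
  have hR : R = ⊤ := by
    by_contra hne
    obtain ⟨f, hf0, hf⟩ := Submodule.exists_le_ker_of_lt_top R (lt_top_iff_ne_top.2 hne)
    obtain ⟨z, hz⟩ : ∃ z, z = ∑ i, op (algebraMap ℝ D (f (Pi.single i 1))) • x i := ⟨_, rfl⟩
    have hz0 : z = 0 := by
      by_contra hz0
      obtain ⟨G, hG, hne⟩ := hirr.exists_mulVec_ne_zero (Matrix.vecMulVec_ne_zero hy ht) hz0
      apply hne
      choose r hrF hr using fun i => hF (G * A i) (mul_mem (hmem G hG) (hmem _ (hAS i)))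
      have hr' : ∀ i, t ⬝ᵥ (G *ᵥ x i) = algebraMap ℝ D (r i) := fun i => by
        rw [← hr i, ← Matrix.mulVec_mulVec, hAx]
      have hker : f (fun i => (⟨r i, hrF i⟩ : F)) = 0 := hf ⟨G, hmem G hG, hr'⟩
      have hsum : t ⬝ᵥ (G *ᵥ z) = 0 := by
        rw [hz, Matrix.mulVec_sum, dotProduct_sum]
        simp only [Matrix.mulVec_smul, dotProduct_smul, hr', op_smul_eq_mul]
        rw [LinearMap.pi_apply_eq_sum_univ] at hker
        have := congrArg (fun c : F => algebraMap ℝ D (c : ℝ)) hker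
        simp only [AddSubmonoidClass.coe_finsetSum, smul_eq_mul, map_sum, ZeroMemClass.coe_zero,
          map_zero, MulMemClass.coe_mul, map_mul] at this
        rw [← this]
        refine Finset.sum_congr rfl fun i _ => ?_
        congr 4
        ext j
        simp [Pi.single_apply, eq_comm]
      rw [Matrix.vecMulVec_mulVec, hsum, op_zero, zero_smul]
    have hcoef := Fintype.linearIndependent_iff.1 hxi _ (hz.symm.trans hz0)
    apply hf0
    refine LinearMap.pi_ext' fun i => LinearMap.ext_ring ?_
    have := hcoef i
    rw [op_eq_zero_iff, map_eq_zero, ZeroMemClass.coe_eq_zero] at this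
    simpa using this
  have hG : ∀ j, ∃ G ∈ algGen F (S : Set (Matrix (Fin n) (Fin n) D)),
      ∀ i, t ⬝ᵥ (G *ᵥ x i) = (1 : Matrix (Fin n) (Fin n) D) j i := by
    intro j
    obtain ⟨G, hG, h⟩ : (Pi.single j 1 : Fin n → F) ∈ R := hR ▸ Submodule.mem_top
    refine ⟨G, hG, fun i => ?_⟩
    rw [h, Matrix.one_apply, Pi.single_apply]
    by_cases hij : j = i
    · simp [hij]
    · simp [hij, Ne.symm hij]
  choose G hGmem hG using hG
  let P : Matrix (Fin n) (Fin n) D := Matrix.of fun k i => x i k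
  let Q : Matrix (Fin n) (Fin n) D := Matrix.of fun j => t ᵥ* G j
  have hQ : ∀ (B : Matrix (Fin n) (Fin n) D) (j i : Fin n),
      (Q * (B * P)) j i = t ⬝ᵥ (G j *ᵥ (B *ᵥ x i)) := by
    intro B j i
    rw [Matrix.dotProduct_mulVec]
    rfl
  have hQP : Q * P = 1 := by
    ext j i
    rw [← hG j i, ← Matrix.one_mul P, hQ, Matrix.one_mulVec]
  have hPQ : P * Q = 1 := mul_eq_one_comm.1 hQP
  refine ⟨⟨Q, P, hQP, hPQ⟩, ?_⟩
  change _ = (fun B => P * B * Q) '' _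
  ext B
  constructor
  · intro hB
    refine ⟨Q * (B * P), fun j i => ?_, ?_⟩
    · obtain ⟨r, hrF, hr⟩ := hF (G j * (B * A i)) (mul_mem (hGmem j) (mul_mem hB (hmem _ (hAS i))))
      refine ⟨r, hrF, ?_⟩
      rw [hQ, ← hr, ← Matrix.mulVec_mulVec, ← Matrix.mulVec_mulVec, hAx]
    · change P * (Q * (B * P)) * Q = B
      rw [← mul_assoc P Q, hPQ, one_mul, mul_assoc, hPQ, mul_one]
  · rintro ⟨M, hM, rfl⟩
    choose m hmF hm using hM
    -- Column $i$ of $P$ is $A_iy$ and row $j$ of $Q$ is $tG_j$, so the matrix units become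
    -- $A_i(yt)G_j$.
    have : P * M * Q = ∑ i, ∑ j, m i j • (A i * (Matrix.vecMulVec y t * G j)) := by
      simp only [Matrix.vecMulVec_mul, Matrix.mul_vecMulVec, hAx]
      ext k l
      simp only [Matrix.mul_apply, Matrix.sum_apply, Finset.sum_mul, Matrix.smul_apply,
        Matrix.vecMulVec_apply, ← hm, P, Q, Matrix.of_apply]
      rw [Finset.sum_comm]
      refine Finset.sum_congr rfl fun i _ => Finset.sum_congr rfl fun j _ => ?_
      rw [← Algebra.commutes, mul_assoc, Algebra.smul_def]
    change P * M * Q ∈ algGen F _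
    rw [this]
    exact sum_mem fun i _ => sum_mem fun j _ => smul_mem_algGen (hmF i j)
      (mul_mem (hmem _ (hAS i)) (mul_mem hT (hGmem j)))

/-- Over a finite-dimensional real division algebra, an irreducible semigroup of triangularizable
matrices with spectra in a subfield `F` of `ℝ` generates, up to similarity, the full matrix algebra
over `F`. -/
theorem isSimilar_matricesOver [FiniteDimensional ℝ D] (F : Subfield ℝ)
    (S : Subsemigroup (Matrix (Fin n) (Fin n) D))
    (hirr : IsIrreducible (S : Set (Matrix (Fin n) (Fin n) D)))
    (htri : ∀ A ∈ S, IsTriangularizable {A}) (hspec : ∀ A ∈ S, rightSpectrum A ⊆ scalars D F) :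
    IsSimilar (algGen F (S : Set (Matrix (Fin n) (Fin n) D)) : Set (Matrix (Fin n) (Fin n) D))
      (matricesOver D n F) := by
  rcases Nat.eq_zero_or_pos n with rfl | hn
  · refine ⟨1, Set.ext fun A => ⟨fun _ => ⟨A, fun i => i.elim0, Subsingleton.elim _ _⟩,
      fun _ => ?_⟩⟩
    rw [Subsingleton.elim A 0]
    exact zero_mem (algGen F _)
  have hS := fun A hA => exists_annihilating_roots (htri A hA) (hspec A hA)
  obtain ⟨E, hE, x, hx, hEx, hline, hreal⟩ := (isSplitCone_realCone hirr hS).exists_rank_one hn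
  obtain ⟨y, t, hy, ht, hT⟩ := exists_vecMulVec_mem_algGen hS hE hx hEx hline
  obtain ⟨y', t', hy', ht', hT', hreal'⟩ := exists_vecMulVec_corner_real hirr hx hEx hline
    (fun B hB => hreal B (subset_realCone _ hB)) hy ht hT
  refine isSimilar_matricesOver_of_rank_one hirr hy' ht' hT' fun B hB => ?_
  obtain ⟨r, hr⟩ := hreal' B hB
  exact ⟨r, corner_mem_of_real (fun A hA => let ⟨l, hl, _, h0⟩ := hS A hA; ⟨l, hl, h0⟩) hT' hB hr,
    hr⟩

end

end MatrixSemigroup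

theorem theorem2p6 (n : ℕ) (F : Subfield ℝ) :
    (∀ S : Subsemigroup (Matrix (Fin n) (Fin n) ℝ),
      MatrixSemigroup.IsIrreducible (S : Set (Matrix (Fin n) (Fin n) ℝ)) →
      (∀ A ∈ S, MatrixSemigroup.IsTriangularizable {A}) →
      (∀ A ∈ S, MatrixSemigroup.rightSpectrum A ⊆ MatrixSemigroup.scalars ℝ F) →
      MatrixSemigroup.IsSimilar
        (MatrixSemigroup.algGen F (S : Set (Matrix (Fin n) (Fin n) ℝ)) :
          Set (Matrix (Fin n) (Fin n) ℝ))
        (MatrixSemigroup.matricesOver ℝ n F)) ∧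
    (∀ S : Subsemigroup (Matrix (Fin n) (Fin n) ℂ),
      MatrixSemigroup.IsIrreducible (S : Set (Matrix (Fin n) (Fin n) ℂ)) →
      (∀ A ∈ S, MatrixSemigroup.IsTriangularizable {A}) →
      (∀ A ∈ S, MatrixSemigroup.rightSpectrum A ⊆ MatrixSemigroup.scalars ℂ F) →
      MatrixSemigroup.IsSimilar
        (MatrixSemigroup.algGen F (S : Set (Matrix (Fin n) (Fin n) ℂ)) :
          Set (Matrix (Fin n) (Fin n) ℂ))
        (MatrixSemigroup.matricesOver ℂ n F)) ∧
    (∀ S : Subsemigroup (Matrix (Fin n) (Fin n) ℍ[ℝ]),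
      MatrixSemigroup.IsIrreducible (S : Set (Matrix (Fin n) (Fin n) ℍ[ℝ])) →
      (∀ A ∈ S, MatrixSemigroup.IsTriangularizable {A}) →
      (∀ A ∈ S, MatrixSemigroup.rightSpectrum A ⊆ MatrixSemigroup.scalars ℍ[ℝ] F) →
      MatrixSemigroup.IsSimilar
        (MatrixSemigroup.algGen F (S : Set (Matrix (Fin n) (Fin n) ℍ[ℝ])) :
          Set (Matrix (Fin n) (Fin n) ℍ[ℝ]))
        (MatrixSemigroup.matricesOver ℍ[ℝ] n F)) := by
  exact ⟨MatrixSemigroup.isSimilar_matricesOver F, MatrixSemigroup.isSimilar_matricesOver F,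
    MatrixSemigroup.isSimilar_matricesOver F⟩
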